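/- Let $K$ be an algebraically closed field, $n\ge 0$, and $K[[X]]=K[[x_1,\dots,x_n]]$. A monic polynomial $f\in K[[X]][y]$ is a *Puiseux polynomial* if $f=\prod_{i=1}^d (y-\xi_i)$ with $\xi_1,\dots,\xi_d\in\bigcup_{m\ge 1}K[[x_1^{1/m},\dots,x_n^{1/m}]]$. The *normalization* $\mathcal N(D)$ of a domain $D$ is its integral closure in its field of fractions. Two points given by maximal ideals $\mathfrak m\subset A$, $\mathfrak m'\subset A'$ of $K$-algebras are *analytically isomorphic* if the completions $\varprojlim_k A/\mathfrak m^k$ and $\varprojlim_k A'/\mathfrak m'^k$ are isomorphic as $K$-algebras; for a local ring the maximal ideal is understood. A *simplicial pair* $(M,\sigma)$ consists of a finitely generated subgroup $M$ of $\mathbb Q^n$ with $\mathbb Z^n\subseteq M$, and a cone $\sigma\subset\mathbb R^n$ generated by $n$ linearly independent vectors of $\mathbb Z^n$. The *special point* of the affine toric variety $\operatorname{Spec}K[M\cap\sigma]$ is the maximal ideal generated by the monomials $x^\alpha$, $0\ne\alpha\in M\cap\sigma$. An *$n$-dimensional Hirzebruch–Jung singularity* is a Noetherian local $K$-algebra that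 is a normal domain, is not regular, and is analytically isomorphic to the special point of $\operatorname{Spec}K[M\cap\sigma]$ for some simplicial pair $(M,\sigma)$ in dimension $n$. 1. Let $f\in K[[X]][y]$ be an irreducible (monic) Puiseux polynomial such that $\operatorname{char}K\nmid\deg f$. Then $\mathcal N(K[[X]][y]/(f))$ is a local ring, and it is either regular or an $n$-dimensional Hirzebruch–Jung singularity. 2. Conversely, every $n$-dimensional Hirzebruch–Jung singularity $R$ is analytically isomorphic to $\mathcal N(K[[X]][y]/(f))$, which is a local ring, for some irreducible (monic) Puiseux polynomial $f\in K[[X]][y]$. If moreover $R$ is analytically isomorphic to the special point of $\operatorname{Spec}K[M\cap\sigma]$ and $\operatorname{char}K$ does not divide the index in $M$ of the subgroup generated by the points of $M$ on the lines spanned by the rays of $\sigma$ (which always holds in characteristic $0$), then $f$ can be chosen with $\operatorname{char}K\nmid\deg f$. -/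

import Mathlib

open Polynomial

namespace PuiseuxHypersurface

universe u v w

/-- A monic `f ∈ K[[x₁,…,xₙ]][y]` is a Puiseux polynomial if it is a product of linear factors
`y - ξᵢ` with `ξᵢ ∈ ⋃ₘ K[[x₁^{1/m},…,xₙ^{1/m}]]`. The (finitely many) `ξᵢ` have a common
denominator `m`, and `K[[x₁^{1/m},…,xₙ^{1/m}]]` is the power series ring `K[[t₁,…,tₙ]]` regarded as
an extension of `K[[x₁,…,xₙ]]` through the embedding `xᵢ ↦ tᵢ ^ m`, which is
`MvPowerSeries.expand m`. -/
def IsPuiseux {K : Type u} [Field K] {n : ℕ} (f : (MvPowerSeries (Fin n) K)[X]) : Prop :=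
  f.Monic ∧ ∃ (m : ℕ) (hm : m ≠ 0) (d : ℕ) (ξ : Fin d → MvPowerSeries (Fin n) K),
    f.map (MvPowerSeries.expand (R := K) (σ := Fin n) m hm).toRingHom = ∏ i, (X - C (ξ i))

/-- The normalization of a domain: its integral closure in its field of fractions. -/
abbrev Normalization (D : Type u) [CommRing D] : Type u :=
  integralClosure D (FractionRing D)

/-- The points given by the maximal ideals `I ⊆ A` and `J ⊆ B` are analytically isomorphic over
`K` if the completions of `A` at `I` and of `B` at `J` are isomorphic `K`-algebras. -/
def AnalyticallyIsomorphic (K : Type u) [Field K] {A : Type v} [CommRing A] [Algebra K A]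
    (I : Ideal A) {B : Type w} [CommRing B] [Algebra K B] (J : Ideal B) : Prop :=
  Nonempty (AdicCompletion I A ≃ₐ[K] AdicCompletion J B)

/-- The convex cone in `ℝⁿ` generated by the integer vectors `v₁, …, vₙ`. -/
noncomputable def cone {n : ℕ} (v : Fin n → Fin n → ℤ) : PointedCone ℝ (Fin n → ℝ) :=
  PointedCone.hull ℝ (Set.range fun i j => (v i j : ℝ))

/-- The semigroup `M ∩ σ`, for a subgroup `M` of `ℚⁿ` and a cone `σ` in `ℝⁿ`. -/
def semigroup {n : ℕ} (M : AddSubgroup (Fin n → ℚ)) (σ : PointedCone ℝ (Fin n → ℝ)) :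
    AddSubmonoid (Fin n → ℚ) where
  carrier := {α | α ∈ M ∧ (fun i => (α i : ℝ)) ∈ σ}
  zero_mem' := ⟨M.zero_mem, by
    have h : (fun i => (((0 : Fin n → ℚ) i : ℚ) : ℝ)) = 0 := by ext; simp
    rw [h]; exact σ.zero_mem⟩
  add_mem' := by
    rintro a b ⟨ha, ha'⟩ ⟨hb, hb'⟩
    refine ⟨M.add_mem ha hb, ?_⟩
    have h : (fun i => (((a + b) i : ℚ) : ℝ)) = (fun i => (a i : ℝ)) + fun i => (b i : ℝ) := by
      ext; simp
    rw [h]; exact σ.add_mem ha' hb'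

/-- The special ideal of the semigroup algebra `K[S]`, generated by the monomials `x ^ α` with
`0 ≠ α ∈ S`. -/
noncomputable def specialIdeal (K : Type u) [Field K] {n : ℕ} (S : AddSubmonoid (Fin n → ℚ)) :
    Ideal (AddMonoidAlgebra K S) :=
  Ideal.span {p | ∃ α : S, α ≠ 0 ∧ p = AddMonoidAlgebra.single α 1}

/-- `M` is a lattice in `ℚⁿ` containing `ℤⁿ`, and `v₁, …, vₙ` are linearly independent integer
vectors, so that they generate a rational simplicial cone of maximal dimension in `ℝⁿ`. -/
structure IsSimplicialPair {n : ℕ} (M : AddSubgroup (Fin n → ℚ)) (v : Fin n → Fin n → ℤ) :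
    Prop where
  fg : M.FG
  int_mem : ∀ a : Fin n → ℤ, (fun i => (a i : ℚ)) ∈ M
  linearIndependent : LinearIndependent ℝ fun i j => (v i j : ℝ)

/-- The sublattice of `M` generated by the points of `M` on the lines through `v₁, …, vₙ`,
equivalently by the primitive generators in `M` of the rays of the cone over `v₁, …, vₙ`. -/
def rayLattice {n : ℕ} (M : AddSubgroup (Fin n → ℚ)) (v : Fin n → Fin n → ℤ) :
    AddSubgroup (Fin n → ℚ) :=
  AddSubgroup.closure {α | α ∈ M ∧ ∃ (i : Fin n) (t : ℚ), α = fun j => t * (v i j : ℚ)}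

/-- The local `K`-algebra `R` is a Hirzebruch–Jung singularity with toric model `(M, σ)`, where
`σ` is the cone over `v₁, …, vₙ`: it is Noetherian, a normal domain, singular, and analytically
isomorphic to the special point of the affine toric variety `Spec K[M ∩ σ]`. -/
structure IsHirzebruchJungOf (K : Type u) [Field K] {n : ℕ} (M : AddSubgroup (Fin n → ℚ))
    (v : Fin n → Fin n → ℤ) (R : Type w) [CommRing R] [Algebra K R] [IsLocalRing R] :
    Prop where
  pair : IsSimplicialPair M v
  noetherian : IsNoetherianRing R
  domain : IsDomain R
  normal : IsIntegrallyClosed R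
  singular : ¬ IsRegularLocalRing R
  analyticallyIsomorphic : AnalyticallyIsomorphic K (IsLocalRing.maximalIdeal R)
    (specialIdeal K (semigroup M (cone v)))

/-- The local `K`-algebra `R` is an `n`-dimensional Hirzebruch–Jung singularity. -/
def IsHirzebruchJung (K : Type u) [Field K] (n : ℕ) (R : Type w) [CommRing R] [Algebra K R]
    [IsLocalRing R] : Prop :=
  ∃ (M : AddSubgroup (Fin n → ℚ)) (v : Fin n → Fin n → ℤ), IsHirzebruchJungOf K M v R

end PuiseuxHypersurface

/-!
Let `f` be an irreducible Puiseux polynomial with `char K ∤ deg f`, with a root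
`ξ ∈ K[[x^{1/m}]]`. As `f` is separable, `m` can be taken prime to `char K`, and then
`K((x^{1/m}))` is a Kummer extension of `K((x))` for which the monomials in a box form a basis of
radicals. As the Galois group acts on these monomials by scalars, `K((x))(ξ)` is spanned by the
monomials it contains. Their exponents form a lattice, so the normalization of `K[[x]][y]/(f)` is
the ring `K[[T]]` of power series with exponents in the monoid `T` of natural points of that
lattice, which is the completion of `K[T]` at its special point.

Conversely, the toric model of a Hirzebruch–Jung singularity is of the form `K[T]` with `T` the
natural points of a lattice `P ⊇ N ℤⁿ`. If `char K ∤ N`, then the field of `K[[T]]` is a Kummer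
extension of `K((x ^ N))`, and a primitive element has a Puiseux minimal polynomial. If
`N = p ^ k m` with `p = char K`, this extension is in general not simple. It becomes simple after
replacing the subring `K[[x ^ N]]` by `K[[xᵢ ^ N wᵢ ^ m]]` for suitable units `wᵢ ∈ K[[T]]`, chosen
one variable at a time so that a single monomial generates the whole extension; adjoining `m`-th
roots and `p`-power roots of the new parameters then splits its minimal polynomial.
-/

namespace PuiseuxHypersurface

/-! ### Power series over a field are integrally closed -/

section Triangular

open MvPowerSeries

variable {ι κ R : Type*} [CommRing R]

theorem exists_forall_eq_mul_add_sum {r : ι → ι → Prop} (wf : WellFounded r) (t : ι → Finset κ)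
    {π : κ → ι} (hπ : ∀ i, ∀ k ∈ t i, r (π k) i) {a : ι → R} (ha : ∀ i, IsUnit (a i))
    (A : ι → κ → R) (g : ι → R) :
    ∃ c : ι → R, ∀ i, g i = a i * c i + ∑ k ∈ t i, A i k * c (π k) := by
  choose b hb using fun i => (ha i).exists_right_inv
  let F : (i : ι) → ((j : ι) → r j i → R) → R := fun i rec =>
    b i * (g i - ∑ k ∈ (t i).attach, A i k * rec (π k) (hπ i k k.2))
  refine ⟨wf.fix F, fun i => ?_⟩
  rw [wf.fix_eq F i, ← mul_assoc, hb, one_mul, ← Finset.sum_attach (t i), sub_add_cancel]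

end Triangular

section IntegrallyClosed

open MvPowerSeries

instance isDomain_mvPowerSeries {σ R : Type*} [Ring R] [IsDomain R] :
    IsDomain (MvPowerSeries σ R) :=
  NoZeroDivisors.to_isDomain _

section LexOrder

variable {σ R K : Type*} [LinearOrder σ] [WellFoundedGT σ] [CommRing R] [IsDomain R] [Field K]

theorem lexOrder_pow {φ : MvPowerSeries σ R} {x : σ →₀ ℕ} (hx : lexOrder φ = toLex x)
    (k : ℕ) : lexOrder (φ ^ k) = toLex (k • x) := by
  induction k with
  | zero =>
    refine le_antisymm ?_ ?_
    · simpa using lexOrder_le_of_coeff_ne_zero (φ := (1 : MvPowerSeries σ R)) (d := 0)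
    · rw [le_lexOrder_iff]
      intro y hy
      simp at hy
  | succ k ih => rw [pow_succ, lexOrder_mul, ih, hx, succ_nsmul]; rfl

theorem le_of_forall_pow_dvd {r b δ : MvPowerSeries σ R} {d x : σ →₀ ℕ}
    (hd : lexOrder b = toLex d) (hx : lexOrder r = toLex x) (hδ : δ ≠ 0)
    (h : ∀ k, b ^ k ∣ δ * r ^ k) : d ≤ x := by
  obtain ⟨e, he⟩ := exists_finsupp_eq_lexOrder_of_ne_zero hδ
  have hr : r ≠ 0 := by rintro rfl; simp at hx
  intro i
  by_contra! hlt
  obtain ⟨c, hc⟩ := h (e i + 1)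
  have hc0 : c ≠ 0 := right_ne_zero_of_mul (hc ▸ mul_ne_zero hδ (pow_ne_zero _ hr))
  obtain ⟨y, hy⟩ := exists_finsupp_eq_lexOrder_of_ne_zero hc0
  have hlex : e + (e i + 1) • x = (e i + 1) • d + y := by
    have := congrArg lexOrder hc
    rw [lexOrder_mul, lexOrder_mul, lexOrder_pow hx, lexOrder_pow hd, he, hy] at this
    exact toLex.injective (by exact_mod_cast this)
  have := DFunLike.congr_fun hlex i
  simp only [Finsupp.add_apply, Finsupp.smul_apply, smul_eq_mul] at this
  nlinarith

theorem exists_coeff_sub_mul_eq_zero (a : MvPowerSeries σ K) {b : MvPowerSeries σ K} {d : σ →₀ ℕ}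
    (hd : lexOrder b = toLex d) :
    ∃ c : MvPowerSeries σ K, ∀ γ, coeff (d + γ) (a - b * c) = 0 := by
  classical
  have hb : IsUnit (coeff d b) := (coeff_ne_zero_of_lexOrder hd.symm).isUnit
  let t (γ : σ →₀ ℕ) := {x ∈ Finset.HasAntidiagonal.antidiagonal (d + γ) | toLex x.2 < toLex γ}
  obtain ⟨c, hc⟩ := exists_forall_eq_mul_add_sum
    (InvImage.wf toLex (wellFounded_lt (α := Lex (σ →₀ ℕ)))) t
    (π := Prod.snd) (fun γ x hx => (Finset.mem_filter.mp hx).2) (fun _ => hb)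
    (fun _ x => coeff x.1 b) fun γ => coeff (d + γ) a
  let c' : MvPowerSeries σ K := c
  refine ⟨c', fun γ => ?_⟩
  have hmem : (d, γ) ∈ Finset.HasAntidiagonal.antidiagonal (d + γ) := by simp
  have hsum : ∑ x ∈ (Finset.HasAntidiagonal.antidiagonal (d + γ)).erase (d, γ),
      coeff x.1 b * coeff x.2 c' = ∑ x ∈ t γ, coeff x.1 b * c x.2 := by
    refine (Finset.sum_subset_zero_on_sdiff (fun x hx => ?_) ?_ fun _ _ => rfl).symm
    · obtain ⟨hx, hlt⟩ := Finset.mem_filter.mp hx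
      exact Finset.mem_erase.mpr ⟨fun h => hlt.ne (by rw [h]), hx⟩
    · rintro ⟨u, v⟩ hx
      simp only [t, Finset.mem_sdiff, Finset.mem_erase, Finset.mem_filter,
        Finset.HasAntidiagonal.mem_antidiagonal, not_and, not_lt] at hx
      obtain ⟨⟨hne, huv⟩, hle⟩ := hx
      have hlt : toLex γ < toLex v := (hle huv).lt_of_ne fun h => hne <| by
        obtain rfl := toLex.injective h
        rw [add_right_cancel huv]
      have hu : toLex u < toLex d := lt_of_not_ge fun hdu =>
        (add_lt_add_of_le_of_lt hdu hlt).ne' (congrArg toLex huv)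
      rw [coeff_eq_zero_of_lt_lexOrder (d := u) (by rw [hd]; exact_mod_cast hu), zero_mul]
  rw [map_sub, MvPowerSeries.coeff_mul, sub_eq_zero, hc γ, ← Finset.add_sum_erase _ _ hmem, hsum]
  rfl

end LexOrder

variable {σ K : Type*} [Field K]

theorem dvd_of_forall_exists_pow_dvd {a b : MvPowerSeries σ K}
    (h : ∀ c, ∃ δ ≠ 0, ∀ k, b ^ k ∣ δ * (a - b * c) ^ k) : b ∣ a := by
  obtain rfl | hb := eq_or_ne b 0
  · obtain rfl : a = 0 := by
      obtain ⟨δ, hδ, h⟩ := h 0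
      simpa [hδ] using h 1
    exact dvd_rfl
  obtain ⟨_, hwf⟩ := exists_wellFoundedLT σ
  let _ : LinearOrder σ := inferInstanceAs (LinearOrder σᵒᵈ)
  have : WellFoundedGT σ := ⟨hwf.wf⟩
  obtain ⟨d, hd⟩ := exists_finsupp_eq_lexOrder_of_ne_zero hb
  obtain ⟨c, hc⟩ := exists_coeff_sub_mul_eq_zero a hd
  obtain hr | hr := eq_or_ne (a - b * c) 0
  · exact ⟨c, sub_eq_zero.mp hr⟩
  obtain ⟨x, hx⟩ := exists_finsupp_eq_lexOrder_of_ne_zero hr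
  obtain ⟨δ, hδ, h⟩ := h c
  obtain ⟨γ, rfl⟩ := le_iff_exists_add.mp (le_of_forall_pow_dvd hd hx hδ h)
  exact absurd (hc γ) (coeff_ne_zero_of_lexOrder hx.symm)

instance isIntegrallyClosed_mvPowerSeries : IsIntegrallyClosed (MvPowerSeries σ K) := by
  let F := FractionRing (MvPowerSeries σ K)
  rw [isIntegrallyClosed_iff F]
  intro x hx
  obtain ⟨a, b, hb, rfl⟩ := IsFractionRing.div_surjective (A := MvPowerSeries σ K) x
  have hb : algebraMap _ F b ≠ 0 := by simpa using nonZeroDivisors.ne_zero hb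
  suffices b ∣ a by
    obtain ⟨c, rfl⟩ := this
    exact ⟨c, by rw [map_mul, mul_div_cancel_left₀ _ hb]⟩
  refine dvd_of_forall_exists_pow_dvd fun c => ?_
  obtain ⟨δ, hδ, hmem⟩ := (hx.sub (isIntegral_algebraMap (x := c))).isAlmostIntegral
  refine ⟨δ, nonZeroDivisors.ne_zero hδ, fun k => ?_⟩
  obtain ⟨y, hy⟩ := hmem k
  refine ⟨y, IsFractionRing.injective _ F ?_⟩
  rw [div_sub' hb, Algebra.smul_def, div_pow, ← mul_div_assoc, eq_div_iff (pow_ne_zero _ hb)] at hy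
  simp only [map_mul, map_pow, map_sub]
  rw [← hy, mul_comm]

end IntegrallyClosed

/-! ### Power series with restricted exponents -/

section Supported

open MvPowerSeries

variable {σ : Type*}

/-- The ring `R[[T]]` of power series all of whose exponents lie in the monoid `T`. -/
def supported (R : Type*) [CommSemiring R] (T : AddSubmonoid (σ →₀ ℕ)) :
    Subalgebra R (MvPowerSeries σ R) where
  carrier := {g | ∀ α, α ∉ T → coeff α g = 0}
  mul_mem' {a b} ha hb α hα := by
    classical
    rw [MvPowerSeries.coeff_mul]
    refine Finset.sum_eq_zero fun x hx => ?_
    rw [Finset.HasAntidiagonal.mem_antidiagonal] at hx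
    by_cases h1 : x.1 ∈ T
    · rw [hb _ fun h2 => hα (hx ▸ T.add_mem h1 h2), mul_zero]
    · rw [ha _ h1, zero_mul]
  add_mem' {a b} ha hb α hα := by rw [map_add, ha α hα, hb α hα, add_zero]
  algebraMap_mem' r α hα := by
    classical
    rw [MvPowerSeries.algebraMap_apply, MvPowerSeries.coeff_C, if_neg]
    rintro rfl
    exact hα T.zero_mem

/-- A submonoid of `ℕ^σ` is full if it contains all differences of its elements that exist in
`ℕ^σ`; equivalently, it consists of the points of `ℕ^σ` in a subgroup of `ℤ^σ`. -/
def IsFull (T : AddSubmonoid (σ →₀ ℕ)) : Prop := ∀ α ∈ T, ∀ β, α + β ∈ T → β ∈ T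

theorem isFull_top : IsFull (⊤ : AddSubmonoid (σ →₀ ℕ)) := fun _ _ _ _ => trivial

variable {R : Type*} {T : AddSubmonoid (σ →₀ ℕ)}

theorem mem_supported [CommSemiring R] {g : MvPowerSeries σ R} :
    g ∈ supported R T ↔ ∀ α, α ∉ T → coeff α g = 0 := Iff.rfl

theorem mem_supported_top [CommSemiring R] (g : MvPowerSeries σ R) : g ∈ supported R ⊤ :=
  fun _ h => absurd trivial h

theorem monomial_mem_supported [CommSemiring R] {α : σ →₀ ℕ} (hα : α ∈ T) (r : R) :
    monomial α r ∈ supported R T := by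
  classical
  intro β hβ
  rw [MvPowerSeries.coeff_monomial, if_neg]
  rintro rfl
  exact hβ hα

theorem mem_supported_of_mul_mem [CommRing R] [NoZeroDivisors R] (hT : IsFull T)
    {a θ : MvPowerSeries σ R} (ha : a ∈ supported R T) (ha0 : a ≠ 0)
    (h : a * θ ∈ supported R T) : θ ∈ supported R T := by
  classical
  let θ' : MvPowerSeries σ R := fun α => if α ∈ T then coeff α θ else 0
  have hθ' : ∀ α, coeff α θ' = if α ∈ T then coeff α θ else 0 := fun α => rfl
  have hmem : θ' ∈ supported R T := fun α hα => by rw [hθ', if_neg hα]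
  suffices a * (θ - θ') = 0 by
    rw [mul_eq_zero, or_iff_right ha0, sub_eq_zero] at this
    rwa [this]
  ext α
  rw [map_zero]
  by_cases hα : α ∈ T
  · rw [MvPowerSeries.coeff_mul]
    refine Finset.sum_eq_zero fun x hx => ?_
    rw [Finset.HasAntidiagonal.mem_antidiagonal] at hx
    by_cases h1 : x.1 ∈ T
    · have h2 : x.2 ∈ T := hT _ h1 _ (hx ▸ hα)
      rw [map_sub, hθ', if_pos h2, sub_self, mul_zero]
    · rw [ha _ h1, zero_mul]
  · rw [mul_sub]
    exact (supported R T).sub_mem h ((supported R T).mul_mem ha hmem) α hα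

end Supported

section Twist

open MvPowerSeries

variable {σ R : Type*} [CommRing R] {N : ℕ}

theorem hasSubst_X_pow_mul [Finite σ] (hN : N ≠ 0) (u : σ → MvPowerSeries σ R) :
    HasSubst fun i => (X i : MvPowerSeries σ R) ^ N * u i :=
  hasSubst_of_constantCoeff_zero fun i => by simp [hN]

/-- The substitution `xᵢ ↦ xᵢ ^ N * uᵢ`. For `uᵢ = 1` it is the embedding of `R[[x]]` into
`R[[x^{1/N}]]`; in positive characteristic it is used with units `uᵢ` for which the
extension of fraction fields is simple even when the characteristic divides `N`. -/
noncomputable def twist [Finite σ] (hN : N ≠ 0) (u : σ → MvPowerSeries σ R) :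
    MvPowerSeries σ R →ₐ[R] MvPowerSeries σ R :=
  substAlgHom (hasSubst_X_pow_mul hN u)

@[simp] theorem twist_X [Finite σ] (hN : N ≠ 0) (u : σ → MvPowerSeries σ R) (i : σ) :
    twist hN u (X i) = X i ^ N * u i := substAlgHom_X _ i

theorem twist_one [Finite σ] (hN : N ≠ 0) :
    twist (σ := σ) (R := R) hN (fun _ => 1) = MvPowerSeries.expand N hN := by
  unfold twist MvPowerSeries.expand
  congr 1
  simp

/-- The power product `u ^ γ = ∏ uᵢ ^ γᵢ`. -/
noncomputable def powProd (u : σ → MvPowerSeries σ R) (γ : σ →₀ ℕ) : MvPowerSeries σ R :=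
  γ.prod fun i e => u i ^ e

theorem prod_X_pow_mul (u : σ → MvPowerSeries σ R) (γ : σ →₀ ℕ) :
    (γ.prod fun i e => ((X i : MvPowerSeries σ R) ^ N * u i) ^ e) =
      monomial (N • γ) 1 * powProd u γ := by
  have hγ : monomial γ (1 : R) = γ.prod fun i e => (X i : MvPowerSeries σ R) ^ e := by
    rw [MvPowerSeries.monomial_one_eq]
  simp only [mul_pow, Finsupp.prod_mul, powProd, pow_right_comm _ N]
  rw [Finsupp.prod, Finset.prod_pow, ← Finsupp.prod, ← hγ, MvPowerSeries.monomial_pow, one_pow]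

theorem le_of_coeff_monomial_mul_ne_zero {α δ : σ →₀ ℕ} {r : R} {g : MvPowerSeries σ R}
    (h : coeff δ (monomial α r * g) ≠ 0) : α ≤ δ := by
  classical
  rw [MvPowerSeries.coeff_monomial_mul] at h
  exact (ite_ne_right_iff.mp h).1

theorem coeff_twist [Finite σ] (hN : N ≠ 0) (u : σ → MvPowerSeries σ R) (g : MvPowerSeries σ R)
    (δ : σ →₀ ℕ) :
    coeff δ (twist hN u g) = ∑ᶠ γ, coeff γ g * coeff δ (monomial (N • γ) 1 * powProd u γ) := by
  rw [twist, substAlgHom_apply, coeff_subst (hasSubst_X_pow_mul hN u)]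
  simp only [prod_X_pow_mul, smul_eq_mul]

theorem coeff_monomial_mul_powProd_self {u : σ → MvPowerSeries σ R}
    (hu : ∀ i, constantCoeff (u i) = 1) (α γ : σ →₀ ℕ) :
    coeff α (monomial α 1 * powProd u γ) = 1 := by
  classical
  rw [MvPowerSeries.coeff_monomial_mul, if_pos le_rfl, tsub_self,
    coeff_zero_eq_constantCoeff_apply, powProd, map_finsuppProd]
  simp [hu]

theorem twist_injective [Finite σ] (hN : N ≠ 0) {u : σ → MvPowerSeries σ R}
    (hu : ∀ i, constantCoeff (u i) = 1) : Function.Injective (twist hN u) := by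
  rw [injective_iff_map_eq_zero]
  intro g hg
  ext β
  induction β using WellFoundedLT.induction with
  | _ β ih =>
    have h := congrArg (MvPowerSeries.coeff (N • β)) hg
    rwa [coeff_twist, map_zero, finsum_eq_single _ β fun γ hγ => ?_,
      coeff_monomial_mul_powProd_self hu, mul_one] at h
    by_contra h0
    have hle : N • γ ≤ N • β := le_of_coeff_monomial_mul_ne_zero (right_ne_zero_of_mul h0)
    have hle : γ ≤ β := fun i => Nat.le_of_mul_le_mul_left (hle i) (Nat.pos_of_ne_zero hN)
    exact left_ne_zero_of_mul h0 (ih γ (hle.lt_of_ne hγ))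

variable {T : AddSubmonoid (σ →₀ ℕ)}

theorem monomial_mul_powProd_mem {u : σ → MvPowerSeries σ R} (hu : ∀ i, u i ∈ supported R T)
    {α : σ →₀ ℕ} (hα : α ∈ T) (γ : σ →₀ ℕ) : monomial α 1 * powProd u γ ∈ supported R T :=
  Subalgebra.mul_mem _ (monomial_mem_supported hα _)
    (Subalgebra.prod_mem _ fun i _ => Subalgebra.pow_mem _ (hu i) _)

theorem twist_mem [Finite σ] (hN : N ≠ 0) (hNT : ∀ α, N • α ∈ T) {u : σ → MvPowerSeries σ R}
    (hu : ∀ i, u i ∈ supported R T) (g : MvPowerSeries σ R) : twist hN u g ∈ supported R T := by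
  intro δ hδ
  rw [coeff_twist]
  refine finsum_eq_zero_of_forall_eq_zero fun γ => ?_
  rw [monomial_mul_powProd_mem hu (hNT γ) γ δ hδ, mul_zero]

end Twist

section Expansion

open MvPowerSeries

variable {σ R : Type*} [CommRing R] {N : ℕ} {T : AddSubmonoid (σ →₀ ℕ)}

/-- The family `e` of power series is unitriangular: `e α = x ^ α` plus terms in proper multiples
of `x ^ α`. -/
def IsUnitriangular (e : (σ →₀ ℕ) → MvPowerSeries σ R) : Prop :=
  (∀ α, coeff α (e α) = 1) ∧ ∀ α δ, coeff δ (e α) ≠ 0 → α ≤ δ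

theorem IsUnitriangular.exists_coeff_eq_finsum [Finite σ] {e : (σ →₀ ℕ) → MvPowerSeries σ R}
    (he : IsUnitriangular e) (heT : ∀ α ∈ T, e α ∈ supported R T) {g : MvPowerSeries σ R}
    (hg : g ∈ supported R T) :
    ∃ c ∈ supported R T, ∀ δ, coeff δ g = ∑ᶠ α, coeff α c * coeff δ (e α) := by
  classical
  have wf := wellFounded_lt (α := σ →₀ ℕ)
  obtain ⟨c, hc⟩ := exists_forall_eq_mul_add_sum wf (fun δ => Finset.Iio δ) (π := id)
    (fun _ _ h => Finset.mem_Iio.mp h) (a := 1) (fun _ => isUnit_one)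
    (fun δ α => coeff δ (e α)) fun δ => coeff δ g
  refine ⟨(c : MvPowerSeries σ R), fun δ => ?_, fun δ => ?_⟩
  · induction δ using wf.induction with
    | _ δ ih =>
      intro hδ
      have h := hc δ
      rw [hg δ hδ, Pi.one_apply, one_mul, Finset.sum_eq_zero fun α hα => ?_, add_zero] at h
      · exact h.symm
      by_cases hαT : α ∈ T
      · rw [heT α hαT δ hδ, zero_mul]
      · rw [id, show c α = 0 from ih α (Finset.mem_Iio.mp hα) hαT, mul_zero]
  · rw [finsum_eq_sum_of_support_subset (s := Finset.Iic δ) _ fun α hα => by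
      simpa using he.2 α δ (right_ne_zero_of_mul hα), ← Finset.Iio_insert,
      Finset.sum_insert (by simp), hc δ, he.1, mul_one, Pi.one_apply, one_mul]
    exact congrArg (c δ + ·) (Finset.sum_congr rfl fun α _ => mul_comm _ _)

/-- The exponent vector of `β ∈ {0, …, N - 1}^σ`. -/
noncomputable def boxExp [Finite σ] (β : σ → Fin N) : σ →₀ ℕ :=
  Finsupp.equivFunOnFinite.symm fun i => (β i : ℕ)

@[simp] theorem boxExp_apply [Finite σ] (β : σ → Fin N) (i : σ) : boxExp β i = β i := rfl

/-- Euclidean division of exponent vectors by `N`. -/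
noncomputable def divModEquiv [Finite σ] (hN : N ≠ 0) : (σ → Fin N) × (σ →₀ ℕ) ≃ (σ →₀ ℕ) where
  toFun x := boxExp x.1 + N • x.2
  invFun α := (fun i => ⟨α i % N, Nat.mod_lt _ (Nat.pos_of_ne_zero hN)⟩,
    Finsupp.equivFunOnFinite.symm fun i => α i / N)
  left_inv := by
    rintro ⟨β, γ⟩
    ext i
    · simp [Nat.add_mul_mod_self_left, Nat.mod_eq_of_lt (β i).2]
    · simp [Nat.add_mul_div_left _ _ (Nat.pos_of_ne_zero hN), Nat.div_eq_of_lt (β i).2]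
  right_inv := by
    intro α
    ext i
    simp [Nat.mod_add_div]

theorem divModEquiv_apply [Finite σ] (hN : N ≠ 0) (β : σ → Fin N) (γ : σ →₀ ℕ) :
    divModEquiv hN (β, γ) = boxExp β + N • γ := rfl

theorem coeff_monomial_mul_twist [Finite σ] (hN : N ≠ 0) (u : σ → MvPowerSeries σ R) (α : σ →₀ ℕ)
    (g : MvPowerSeries σ R) (δ : σ →₀ ℕ) :
    coeff δ (monomial α 1 * twist hN u g) =
      ∑ᶠ γ, coeff γ g * coeff δ (monomial (α + N • γ) 1 * powProd u γ) := by
  classical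
  have hmon (γ : σ →₀ ℕ) : monomial (α + N • γ) 1 * powProd u γ =
      monomial α 1 * (monomial (N • γ) 1 * powProd u γ) := by
    rw [← mul_assoc, MvPowerSeries.monomial_mul_monomial, one_mul]
  simp only [hmon]
  rw [MvPowerSeries.coeff_monomial_mul]
  simp only [MvPowerSeries.coeff_monomial_mul (n := α), one_mul]
  split_ifs with h
  · rw [coeff_twist]
  · simp

/-- The series `x ^ (β + N γ) * u ^ γ`, for `β ∈ {0, …, N - 1}^σ`, form a unitriangular family, and
those with a fixed `β` expand the multiples of `x ^ β` by the image of the substitution. -/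
theorem exists_eq_sum_twist [Fintype σ] [DecidableEq σ] (hN : N ≠ 0) (hT : IsFull T)
    (hNT : ∀ α, N • α ∈ T) {u : σ → MvPowerSeries σ R} (hu : ∀ i, u i ∈ supported R T)
    (hu1 : ∀ i, constantCoeff (u i) = 1) {g : MvPowerSeries σ R} (hg : g ∈ supported R T) :
    ∃ h : (σ → Fin N) → MvPowerSeries σ R, (∀ β, boxExp β ∉ T → h β = 0) ∧
      g = ∑ β, MvPowerSeries.monomial (boxExp β) 1 * twist hN u (h β) := by
  let e (α : σ →₀ ℕ) : MvPowerSeries σ R :=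
    monomial α 1 * powProd u ((divModEquiv hN).symm α).2
  have he : IsUnitriangular e := ⟨fun α => coeff_monomial_mul_powProd_self hu1 α _,
    fun α δ => le_of_coeff_monomial_mul_ne_zero⟩
  obtain ⟨c, hcT, hc⟩ := he.exists_coeff_eq_finsum
    (fun α hα => monomial_mul_powProd_mem hu hα _) hg
  let h (β : σ → Fin N) : MvPowerSeries σ R := fun γ => coeff (boxExp β + N • γ) c
  refine ⟨h, fun β hβ => ?_, ?_⟩
  · ext γ
    exact hcT _ fun h => hβ (hT _ (hNT γ) _ (by rwa [add_comm]))
  · ext δ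
    have hfin : (Function.support fun α => coeff α c * coeff δ (e α)).Finite :=
      (Finset.Iic δ).finite_toSet.subset fun α hα => by
        simpa using he.2 α δ (right_ne_zero_of_mul hα)
    rw [map_sum, hc, ← finsum_comp_equiv (divModEquiv hN), finsum_curry _ <|
      hfin.preimage (divModEquiv hN).injective.injOn, finsum_eq_sum_of_fintype]
    refine Finset.sum_congr rfl fun β _ => ?_
    refine (finsum_congr fun γ => ?_).trans (coeff_monomial_mul_twist hN u _ (h β) δ).symm
    simp only [e, Equiv.symm_apply_apply]
    rfl

end Expansion

/-! ### Completions and monomial semigroup rings -/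

section Completion

variable {K : Type*} [Field K] {A B C : Type*} [CommRing A] [Algebra K A] [CommRing B]
  [Algebra K B] [CommRing C] [Algebra K C] {I : Ideal A} {J : Ideal B}

theorem factorₐ_evalₐ {k l : ℕ} (hkl : k ≤ l) (x : AdicCompletion I A) :
    Ideal.Quotient.factorₐ K (Ideal.pow_le_pow_right hkl) (AdicCompletion.evalₐ I l x) =
      AdicCompletion.evalₐ I k x := by
  induction x using AdicCompletion.induction_on with
  | _ x =>
    rw [AdicCompletion.evalₐ_mk, AdicCompletion.evalₐ_mk]
    exact AdicCompletion.Ideal.mk_eq_mk I hkl x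

theorem AnalyticallyIsomorphic.of_quotient_algEquiv (e : ∀ k, (A ⧸ I ^ k) ≃ₐ[K] (B ⧸ J ^ k))
    (he : ∀ {k l : ℕ} (hkl : k ≤ l) x,
      Ideal.Quotient.factorₐ K (Ideal.pow_le_pow_right hkl) (e l x) =
        e k (Ideal.Quotient.factorₐ K (Ideal.pow_le_pow_right hkl) x)) :
    AnalyticallyIsomorphic K I J := by
  have he' {k l : ℕ} (hkl : k ≤ l) (y : B ⧸ J ^ l) :
      Ideal.Quotient.factorₐ K (Ideal.pow_le_pow_right hkl) ((e l).symm y) =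
        (e k).symm (Ideal.Quotient.factorₐ K (Ideal.pow_le_pow_right hkl) y) := by
    rw [AlgEquiv.eq_symm_apply, ← he hkl, AlgEquiv.apply_symm_apply]
  let F : AdicCompletion I A →ₐ[K] AdicCompletion J B := AdicCompletion.liftAlgHom J
    (fun k => (e k).toAlgHom.comp ((AdicCompletion.evalₐ I k).restrictScalars K)) fun hkl => by
      ext x
      exact (he hkl _).trans (congrArg (e _) (factorₐ_evalₐ hkl x))
  let G : AdicCompletion J B →ₐ[K] AdicCompletion I A := AdicCompletion.liftAlgHom I
    (fun k => (e k).symm.toAlgHom.comp ((AdicCompletion.evalₐ J k).restrictScalars K))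
    fun hkl => by
      ext x
      exact (he' hkl _).trans (congrArg (e _).symm (factorₐ_evalₐ hkl x))
  exact ⟨AlgEquiv.ofAlgHom F G
    (AlgHom.ext fun y => AdicCompletion.ext_evalₐ fun k => by simp [F, G])
    (AlgHom.ext fun x => AdicCompletion.ext_evalₐ fun k => by simp [F, G])⟩

theorem AnalyticallyIsomorphic.of_algHom (φ : A →ₐ[K] B)
    (hφ : ∀ k a, φ a ∈ J ^ k ↔ a ∈ I ^ k) (hφ' : ∀ k b, ∃ a, b - φ a ∈ J ^ k) :
    AnalyticallyIsomorphic K I J := by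
  let f (k : ℕ) : (A ⧸ I ^ k) →ₐ[K] (B ⧸ J ^ k) :=
    Ideal.quotientMapₐ (J ^ k) φ fun a ha => (hφ k a).mpr ha
  have hf (k : ℕ) : Function.Bijective (f k) := by
    constructor
    · rw [injective_iff_map_eq_zero]
      intro x hx
      obtain ⟨a, rfl⟩ := Ideal.Quotient.mk_surjective x
      exact Ideal.Quotient.eq_zero_iff_mem.mpr
        ((hφ k a).mp (Ideal.Quotient.eq_zero_iff_mem.mp hx))
    · intro y
      obtain ⟨b, rfl⟩ := Ideal.Quotient.mk_surjective y
      obtain ⟨a, ha⟩ := hφ' k b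
      exact ⟨Ideal.Quotient.mk _ a, (Ideal.Quotient.eq.mpr ha).symm⟩
  refine .of_quotient_algEquiv (fun k => AlgEquiv.ofBijective (f k) (hf k)) fun hkl x => ?_
  obtain ⟨a, rfl⟩ := Ideal.Quotient.mk_surjective x
  rfl

theorem AnalyticallyIsomorphic.symm (h : AnalyticallyIsomorphic K I J) :
    AnalyticallyIsomorphic K J I :=
  h.map AlgEquiv.symm

theorem AnalyticallyIsomorphic.trans {L : Ideal C} (h : AnalyticallyIsomorphic K I J)
    (h' : AnalyticallyIsomorphic K J L) : AnalyticallyIsomorphic K I L :=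
  h.map2 AlgEquiv.trans h'

theorem AnalyticallyIsomorphic.of_algEquiv [IsLocalRing A] [IsLocalRing B] (e : A ≃ₐ[K] B) :
    AnalyticallyIsomorphic K (IsLocalRing.maximalIdeal A) (IsLocalRing.maximalIdeal B) := by
  have he : (IsLocalRing.maximalIdeal A).map (e : A ≃+* B) = IsLocalRing.maximalIdeal B := by
    rw [show IsLocalRing.maximalIdeal A = (IsLocalRing.maximalIdeal B).comap (e : A ≃+* B) by
      ext a; simp [IsLocalRing.mem_maximalIdeal, mem_nonunits_iff]]
    exact Ideal.map_comap_of_surjective _ e.surjective _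
  refine .of_algHom e.toAlgHom (fun k a => ?_) fun k b => ⟨e.symm b, by simp⟩
  rw [← he, ← Ideal.map_pow]
  change (e : A ≃+* B) a ∈ _ ↔ _
  rw [Ideal.mem_map_of_equiv]
  simp

end Completion

section OrderGE

open scoped Pointwise

variable {M : Type*} [AddCommMonoid M]

/-- The elements of the monoid `T` of the form `β₁ + ⋯ + βₖ + γ` with all `βᵢ` nonzero. These are
the exponents of the monomials in the `k`-th power of the ideal generated by the nontrivial
monomials. -/
def orderGE (T : AddSubmonoid M) (k : ℕ) : Set M :=
  k • ((T : Set M) \ {0}) + (T : Set M)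

variable {T : AddSubmonoid M}

theorem orderGE_zero : orderGE T 0 = T := by
  rw [orderGE, zero_nsmul, zero_add]

theorem orderGE_succ (k : ℕ) : orderGE T (k + 1) = ((T : Set M) \ {0}) + orderGE T k := by
  rw [orderGE, succ_nsmul', add_assoc, orderGE]

theorem add_orderGE (k : ℕ) : (T : Set M) + orderGE T k = orderGE T k := by
  rw [orderGE, add_left_comm, AddSubmonoid.coe_add_self_eq]

theorem orderGE_subset (k : ℕ) : orderGE T k ⊆ T := by
  induction k with
  | zero => rw [orderGE_zero]
  | succ k ih =>
    rw [orderGE_succ]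
    exact (Set.add_subset_add Set.sdiff_subset ih).trans (AddSubmonoid.coe_add_self_eq T).subset

theorem exists_generator_add {G : Set M} {β : M} (hβ : β ∈ AddSubmonoid.closure G) (h0 : β ≠ 0) :
    ∃ γ ∈ G \ {0}, ∃ δ ∈ AddSubmonoid.closure G, β = γ + δ := by
  induction hβ using AddSubmonoid.closure_induction with
  | mem x hx => exact ⟨x, ⟨hx, h0⟩, 0, zero_mem _, (add_zero x).symm⟩
  | zero => exact absurd rfl h0
  | add x y _ hy ihx ihy =>
    obtain rfl | hx0 := eq_or_ne x 0
    · rw [zero_add] at h0 ⊢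
      exact ihy h0
    · obtain ⟨γ, hγ, δ, hδ, rfl⟩ := ihx hx0
      exact ⟨γ, hγ, δ + y, add_mem hδ hy, add_assoc _ _ _⟩

theorem orderGE_succ_eq_of_closure {G : Set M} (hG : AddSubmonoid.closure G = T) (k : ℕ) :
    orderGE T (k + 1) = G \ {0} + orderGE T k := by
  subst hG
  refine subset_antisymm ?_ ?_
  · rw [orderGE_succ]
    rintro _ ⟨β, ⟨hβ, h0⟩, δ, hδ, rfl⟩
    obtain ⟨γ, hγ, ε, hε, rfl⟩ := exists_generator_add hβ h0
    refine ⟨γ, hγ, ε + δ, ?_, (add_assoc _ _ _).symm⟩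
    rw [← add_orderGE]
    exact Set.add_mem_add hε hδ
  · rw [orderGE_succ]
    exact Set.add_subset_add_right (Set.sdiff_subset_sdiff_left AddSubmonoid.subset_closure)

theorem finite_sdiff_orderGE (hT : T.FG) (k : ℕ) : ((T : Set M) \ orderGE T k).Finite := by
  obtain ⟨G, hG⟩ := hT
  induction k with
  | zero => simp [orderGE_zero]
  | succ k ih =>
    refine ((Set.finite_singleton 0).union (G.finite_toSet.add ih)).subset ?_
    rintro α ⟨hα, hα'⟩
    obtain rfl | h0 := eq_or_ne α 0
    · exact Or.inl rfl
    · obtain ⟨γ, hγ, δ, hδ, rfl⟩ := exists_generator_add (hG ▸ hα) h0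
      rw [orderGE_succ_eq_of_closure hG] at hα'
      exact Or.inr ⟨γ, hγ.1, δ, ⟨hG ▸ hδ, fun h => hα' (Set.add_mem_add hγ h)⟩, rfl⟩

end OrderGE

section SemigroupRing

open MvPowerSeries
open scoped Pointwise

variable {σ K : Type*} [Field K] {T : AddSubmonoid (σ →₀ ℕ)}

/-- The ideal of power series in `K[[T]]` without constant term. -/
noncomputable def constIdeal (K : Type*) [Field K] (T : AddSubmonoid (σ →₀ ℕ)) :
    Ideal (supported K T) :=
  RingHom.ker ((constantCoeff (σ := σ) (R := K)).comp (supported K T).subtype)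

theorem mem_constIdeal {g : supported K T} :
    g ∈ constIdeal K T ↔ constantCoeff (g : MvPowerSeries σ K) = 0 := Iff.rfl

theorem coeff_eq_zero_of_mem_constIdeal_pow {k : ℕ} {g : supported K T}
    (hg : g ∈ constIdeal K T ^ k) {α : σ →₀ ℕ} (hα : α ∉ orderGE T k) :
    MvPowerSeries.coeff α (g : MvPowerSeries σ K) = 0 := by
  classical
  induction k generalizing g α with
  | zero => exact g.2 α (by rwa [orderGE_zero] at hα)
  | succ k ih =>
    rw [pow_succ'] at hg
    induction hg using Submodule.mul_induction_on' with
    | mem_mul_mem a ha b hb =>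
      rw [MulMemClass.coe_mul, MvPowerSeries.coeff_mul]
      refine Finset.sum_eq_zero fun x hx => ?_
      rw [Finset.HasAntidiagonal.mem_antidiagonal] at hx
      by_contra hne
      have h1 : x.1 ∈ T := by
        by_contra h
        exact left_ne_zero_of_mul hne (a.2 _ h)
      have h0 : x.1 ≠ 0 := fun h => left_ne_zero_of_mul hne (by
        rw [h, coeff_zero_eq_constantCoeff_apply, mem_constIdeal.mp ha])
      have h2 : x.2 ∈ orderGE T k := by
        by_contra h
        exact right_ne_zero_of_mul hne (ih hb h)
      rw [orderGE_succ] at hα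
      exact hα ⟨x.1, ⟨h1, h0⟩, x.2, h2, hx⟩
    | add a _ b _ iha ihb => rw [AddMemClass.coe_add, map_add, iha, ihb, add_zero]

theorem exists_eq_sum_monomial_mul (G : Finset (σ →₀ ℕ)) (B : Set (σ →₀ ℕ))
    {g : MvPowerSeries σ K} (hg : ∀ α, α ∉ (G : Set (σ →₀ ℕ)) + B → coeff α g = 0) :
    ∃ q : (σ →₀ ℕ) → MvPowerSeries σ K, (∀ γ, ∀ α ∉ B, coeff α (q γ) = 0) ∧
      g = ∑ γ ∈ G, MvPowerSeries.monomial γ 1 * q γ := by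
  classical
  induction G using Finset.induction_on generalizing g with
  | empty =>
    refine ⟨0, by simp, ?_⟩
    ext α
    simp [hg α]
  | insert γ G hγ ih =>
    let r : MvPowerSeries σ K := fun β => if β ∈ B then coeff (γ + β) g else 0
    have hr (β) : coeff β r = if β ∈ B then coeff (γ + β) g else 0 := rfl
    obtain ⟨q, hqB, hq⟩ := ih (g := g - monomial γ 1 * r) fun α hα => by
      rw [map_sub, MvPowerSeries.coeff_monomial_mul, one_mul, hr]
      by_cases h : γ ≤ α ∧ α - γ ∈ B
      · rw [if_pos h.1, if_pos h.2, add_tsub_cancel_of_le h.1, sub_self]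
      · rw [← ite_and, if_neg h, sub_zero]
        refine hg α ?_
        rw [Finset.coe_insert, Set.insert_eq, Set.union_add, Set.singleton_add]
        rintro (⟨β, hβ, rfl⟩ | h')
        · exact h ⟨le_self_add, by simpa using hβ⟩
        · exact hα h'
    refine ⟨Function.update q γ r, fun δ α hα => ?_, ?_⟩
    · obtain rfl | hδ := eq_or_ne δ γ
      · rw [Function.update_self, hr, if_neg hα]
      · rw [Function.update_of_ne hδ, hqB δ α hα]
    · rw [Finset.sum_insert hγ, Function.update_self, ← sub_eq_iff_eq_add', hq]
      refine Finset.sum_congr rfl fun δ hδ => ?_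
      rw [Function.update_of_ne (ne_of_mem_of_not_mem hδ hγ)]

theorem mem_constIdeal_pow (hT : T.FG) {k : ℕ} {g : supported K T} :
    g ∈ constIdeal K T ^ k ↔
      ∀ α ∉ orderGE T k, MvPowerSeries.coeff α (g : MvPowerSeries σ K) = 0 := by
  classical
  refine ⟨fun hg α hα => coeff_eq_zero_of_mem_constIdeal_pow hg hα, fun hg => ?_⟩
  induction k generalizing g with
  | zero => simp
  | succ k ih =>
    obtain ⟨G, hG⟩ := hT
    have hGT (γ : ↥(G \ {0})) : γ.1 ∈ T :=
      hG ▸ AddSubmonoid.subset_closure (Finset.sdiff_subset γ.2)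
    rw [orderGE_succ_eq_of_closure hG, ← Finset.coe_singleton, ← Finset.coe_sdiff] at hg
    obtain ⟨q, hqB, hq⟩ := exists_eq_sum_monomial_mul (G \ {0}) _ hg
    have hqT (γ) : q γ ∈ supported K T := fun α hα => hqB γ α fun h => hα (orderGE_subset k h)
    have hsum : g = ∑ γ : ↥(G \ {0}),
        (⟨monomial γ.1 1, monomial_mem_supported (hGT γ) 1⟩ * ⟨q γ, hqT γ⟩ : supported K T) := by
      refine Subtype.ext (hq.trans ?_)
      rw [AddSubmonoidClass.coe_finsetSum]
      exact (Finset.sum_coe_sort (G \ {0}) fun γ => MvPowerSeries.monomial γ (1 : K) * q γ).symm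
    rw [hsum, pow_succ']
    refine Ideal.sum_mem _ fun γ _ => Ideal.mul_mem_mul ?_ (ih (hqB γ))
    rw [mem_constIdeal, ← coeff_zero_eq_constantCoeff_apply, MvPowerSeries.coeff_monomial,
      if_neg fun h => (Finset.mem_sdiff.mp γ.2).2 (Finset.mem_singleton.mpr h.symm)]

variable {n : ℕ} {S : AddSubmonoid (Fin n → ℚ)}

/-- The embedding of the semigroup algebra `K[S]` into `K[[T]]` given by an isomorphism `S ≃ T`. -/
noncomputable def toSeries (K : Type*) [Field K] (ε : S ≃+ T) :
    AddMonoidAlgebra K S →ₐ[K] supported K T :=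
  AddMonoidAlgebra.lift K (supported K T) S
    { toFun := fun s => ⟨monomial (ε s.toAdd).1 1, monomial_mem_supported (ε s.toAdd).2 1⟩
      map_one' := by
        apply Subtype.ext
        simp [MvPowerSeries.monomial_zero_one]
      map_mul' := fun s t => by
        apply Subtype.ext
        simp [MvPowerSeries.monomial_mul_monomial] }

theorem coe_toSeries_single (ε : S ≃+ T) (s : S) (c : K) :
    (toSeries K ε (AddMonoidAlgebra.single s c) : MvPowerSeries σ K) = monomial (ε s).1 c := by
  classical
  rw [toSeries, AddMonoidAlgebra.lift_single]
  ext α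
  simp [MvPowerSeries.coeff_monomial]

theorem coeff_toSeries (ε : S ≃+ T) (p : AddMonoidAlgebra K S) (s : S) :
    MvPowerSeries.coeff (ε s).1 (toSeries K ε p : MvPowerSeries σ K) = p.coeff s := by
  classical
  induction p using AddMonoidAlgebra.induction_linear with
  | zero => simp
  | add p q hp hq => rw [map_add, AddMemClass.coe_add, map_add, hp, hq]; rfl
  | single t c =>
    rw [coe_toSeries_single, MvPowerSeries.coeff_monomial, AddMonoidAlgebra.coeff_single,
      Finsupp.single_apply]
    refine if_congr ?_ rfl rfl
    rw [Subtype.coe_inj, ε.injective.eq_iff, eq_comm]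

theorem single_mem_specialIdeal_pow (ε : S ≃+ T) {k : ℕ} {s : S} (hs : (ε s).1 ∈ orderGE T k)
    (c : K) : AddMonoidAlgebra.single s c ∈ specialIdeal K S ^ k := by
  induction k generalizing s with
  | zero => simp
  | succ k ih =>
    rw [orderGE_succ] at hs
    obtain ⟨β, ⟨hβ, hβ0⟩, γ, hγ, h⟩ := hs
    obtain ⟨β, rfl⟩ : ∃ b, (ε b).1 = β := ⟨ε.symm ⟨β, hβ⟩, by simp⟩
    obtain ⟨γ, rfl⟩ : ∃ c, (ε c).1 = γ := ⟨ε.symm ⟨γ, orderGE_subset k hγ⟩, by simp⟩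
    obtain rfl : β + γ = s := ε.injective (Subtype.ext (by rw [map_add]; exact h))
    rw [← one_mul c, ← AddMonoidAlgebra.single_mul_single, pow_succ']
    refine Ideal.mul_mem_mul (Ideal.subset_span ⟨β, ?_, rfl⟩) (ih hγ)
    rintro rfl
    exact hβ0 (by simp)

theorem specialIdeal_le_comap_toSeries (ε : S ≃+ T) :
    specialIdeal K S ≤ (constIdeal K T).comap (toSeries K ε) := by
  classical
  rw [specialIdeal, Ideal.span_le]
  rintro _ ⟨α, hα, rfl⟩
  rw [SetLike.mem_coe, Ideal.mem_comap, mem_constIdeal, coe_toSeries_single,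
    ← coeff_zero_eq_constantCoeff_apply, MvPowerSeries.coeff_monomial, if_neg]
  exact fun h => hα (ε.map_eq_zero_iff.mp (Subtype.ext h.symm))

theorem toSeries_mem_constIdeal_pow (ε : S ≃+ T) (k : ℕ) (p : AddMonoidAlgebra K S) :
    toSeries K ε p ∈ constIdeal K T ^ k ↔ p ∈ specialIdeal K S ^ k := by
  refine ⟨fun hp => ?_, fun hp => ?_⟩
  · rw [← AddMonoidAlgebra.sum_coeff_single p, Finsupp.sum]
    refine Ideal.sum_mem _ fun s hs => single_mem_specialIdeal_pow ε ?_ _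
    by_contra h
    rw [Finsupp.mem_support_iff, ← coeff_toSeries ε] at hs
    exact hs (coeff_eq_zero_of_mem_constIdeal_pow hp h)
  · exact Ideal.le_comap_pow _ k
      (Ideal.pow_right_mono (specialIdeal_le_comap_toSeries ε) k hp)

theorem exists_sub_toSeries_mem (hT : T.FG) (ε : S ≃+ T) (k : ℕ) (g : supported K T) :
    ∃ p, g - toSeries K ε p ∈ constIdeal K T ^ k := by
  classical
  have hfin : {s : S | (ε s).1 ∉ orderGE T k}.Finite :=
    Set.Finite.of_injOn (f := fun s => (ε s).1) (t := (T : Set (σ →₀ ℕ)) \ orderGE T k)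
      (fun s hs => ⟨(ε s).2, hs⟩) (fun s _ t _ h => ε.injective (Subtype.ext h))
      (finite_sdiff_orderGE hT k)
  let p : AddMonoidAlgebra K S := AddMonoidAlgebra.ofCoeff <|
    Finsupp.onFinset hfin.toFinset
      (fun s => if (ε s).1 ∈ orderGE T k then 0 else MvPowerSeries.coeff (ε s).1 g.1)
      fun s hs => hfin.mem_toFinset.mpr fun h => hs (if_pos h)
  refine ⟨p, (mem_constIdeal_pow hT).mpr fun α hα => ?_⟩
  by_cases hαT : α ∈ T
  · obtain ⟨s, rfl⟩ : ∃ s, (ε s).1 = α := ⟨ε.symm ⟨α, hαT⟩, by simp⟩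
    rw [AddSubgroupClass.coe_sub, map_sub, coeff_toSeries, AddMonoidAlgebra.coeff_ofCoeff,
      Finsupp.onFinset_apply, if_neg hα, sub_self]
  · exact (g - _).2 α hαT

theorem analyticallyIsomorphic_supported (hT : T.FG) (ε : S ≃+ T) :
    AnalyticallyIsomorphic K (specialIdeal K S) (constIdeal K T) :=
  .of_algHom (toSeries K ε) (toSeries_mem_constIdeal_pow ε) (exists_sub_toSeries_mem hT ε)

end SemigroupRing

section Local

open MvPowerSeries

variable {σ K : Type*} [Field K] {T : AddSubmonoid (σ →₀ ℕ)}

theorem isUnit_supported (hT : IsFull T) {g : supported K T}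
    (hg : constantCoeff (g : MvPowerSeries σ K) ≠ 0) : IsUnit g := by
  have h := MvPowerSeries.mul_inv_cancel _ hg
  have h0 : (g : MvPowerSeries σ K) ≠ 0 := fun h0 => hg (by rw [h0, map_zero])
  refine IsUnit.of_mul_eq_one (b := ⟨(g : MvPowerSeries σ K)⁻¹,
    mem_supported_of_mul_mem hT g.2 h0 ?_⟩) (Subtype.ext h)
  rw [h]
  exact one_mem _

theorem isLocalRing_supported (hT : IsFull T) : IsLocalRing (supported K T) := by
  refine IsLocalRing.of_isUnit_or_isUnit_one_sub_self fun g => ?_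
  by_cases hg : constantCoeff (g : MvPowerSeries σ K) = 0
  · exact Or.inr (isUnit_supported hT (by simp [hg]))
  · exact Or.inl (isUnit_supported hT hg)

theorem maximalIdeal_supported (hT : IsFull T) [IsLocalRing (supported K T)] :
    IsLocalRing.maximalIdeal (supported K T) = constIdeal K T := by
  ext g
  rw [IsLocalRing.mem_maximalIdeal, mem_nonunits_iff, mem_constIdeal]
  refine ⟨fun h => ?_, fun h hu => ?_⟩
  · by_contra h'
    exact h (isUnit_supported hT h')
  · exact (hu.map ((constantCoeff (σ := σ) (R := K)).comp
      (supported K T).val.toRingHom)).ne_zero h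

theorem fg_of_isFull [Finite σ] {N : ℕ} (hN : N ≠ 0) (hT : IsFull T) (hNT : ∀ α, N • α ∈ T) :
    T.FG := by
  cases nonempty_fintype σ
  have hbox : ((T : Set (σ →₀ ℕ)) ∩ Set.range (boxExp (σ := σ) (N := N))).Finite :=
    (Set.finite_range _).inter_of_right _
  have hfin := hbox.union (Set.finite_range fun i : σ => N • Finsupp.single i 1)
  refine ⟨hfin.toFinset, ?_⟩
  rw [Set.Finite.coe_toFinset]
  refine le_antisymm ?_ fun α hα => ?_
  · rw [AddSubmonoid.closure_le]
    rintro _ (⟨h, -⟩ | ⟨i, rfl⟩)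
    · exact h
    · exact hNT _
  · obtain ⟨⟨β, γ⟩, rfl⟩ := (divModEquiv hN).surjective α
    rw [divModEquiv_apply] at hα ⊢
    have hβ : boxExp β ∈ T := hT _ (hNT γ) _ (by rwa [add_comm])
    have hγ : N • γ = ∑ i, γ i • (N • Finsupp.single i 1 : σ →₀ ℕ) := by
      conv_lhs => rw [← Finsupp.univ_sum_single γ, Finset.smul_sum]
      simp [mul_comm]
    refine add_mem (AddSubmonoid.subset_closure (Or.inl ⟨hβ, β, rfl⟩)) ?_
    rw [hγ]
    refine AddSubmonoid.sum_mem _ fun i _ => AddSubmonoid.nsmul_mem _ ?_ _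
    exact AddSubmonoid.subset_closure (Or.inr ⟨i, rfl⟩)

end Local

/-! ### Lattices and simplicial cones -/

section Lattice

section LatMap

variable {ι V : Type*} [Fintype ι] [AddCommGroup V] [Module ℚ V]

/-- The parametrization `z ↦ (∑ i, zᵢ wᵢ) / N` of the lattice generated by the vectors `wᵢ / N`. -/
noncomputable def latMap (N : ℕ) (w : ι → V) : (ι → ℤ) →+ V :=
  (DistribSMul.toAddMonoidHom V (N : ℚ)⁻¹).comp (Fintype.linearCombination ℤ w).toAddMonoidHom

theorem latMap_apply (N : ℕ) (w : ι → V) (z : ι → ℤ) :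
    latMap N w z = (N : ℚ)⁻¹ • ∑ i, z i • w i := rfl

theorem latMap_nsmul {N : ℕ} (hN : N ≠ 0) (w : ι → V) (z : ι → ℤ) :
    latMap N w (N • z) = ∑ i, z i • w i := by
  rw [map_nsmul, latMap_apply, ← Nat.cast_smul_eq_nsmul ℚ,
    smul_inv_smul₀ (Nat.cast_ne_zero.mpr hN)]

theorem mem_range_latMap {N : ℕ} (hN : N ≠ 0) {w : ι → V} {α : V} :
    α ∈ (latMap N w).range ↔ N • α ∈ AddSubgroup.closure (Set.range w) := by
  rw [← Submodule.span_int_eq_addSubgroupClosure, Submodule.mem_toAddSubgroup,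
    Submodule.mem_span_range_iff_exists_fun]
  refine exists_congr fun z => ?_
  rw [latMap_apply, inv_smul_eq_iff₀ (Nat.cast_ne_zero.mpr hN), Nat.cast_smul_eq_nsmul]

theorem latMap_injective {N : ℕ} (hN : N ≠ 0) {w : ι → V} (hw : LinearIndependent ℚ w) :
    Function.Injective (latMap N w) :=
  (smul_right_injective V (inv_ne_zero (Nat.cast_ne_zero.mpr hN))).comp
    (hw.restrict_scalars' ℤ).fintypeLinearCombination_injective

theorem nsmul_mem_comap_latMap {M : AddSubgroup V} {w : ι → V} (hw : ∀ i, w i ∈ M) {N : ℕ}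
    (hN : N ≠ 0) (z : ι → ℤ) : N • z ∈ M.comap (latMap N w) := by
  rw [AddSubgroup.mem_comap, latMap_nsmul hN]
  exact sum_mem fun i _ => zsmul_mem (hw i) _

omit [Fintype ι] in
theorem exists_nsmul_mem_closure [Finite ι] {w : ι → V}
    (hw : Submodule.span ℚ (Set.range w) = ⊤) (α : V) :
    ∃ N : ℕ, N ≠ 0 ∧ N • α ∈ AddSubgroup.closure (Set.range w) := by
  have := Fintype.ofFinite ι
  obtain ⟨c, rfl⟩ := (Submodule.mem_span_range_iff_exists_fun ℚ).mp
    (hw ▸ Submodule.mem_top : α ∈ Submodule.span ℚ (Set.range w))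
  obtain ⟨b, hb⟩ := IsLocalization.exist_integer_multiples_of_finite (nonZeroDivisors ℤ) c
  choose z hz using hb
  have hmem : (b : ℤ) • ∑ i, c i • w i ∈ AddSubgroup.closure (Set.range w) := by
    rw [Finset.smul_sum]
    refine sum_mem fun i _ => ?_
    rw [← smul_assoc, show (b : ℤ) • c i = (z i : ℚ) from (hz i).symm, Int.cast_smul_eq_zsmul]
    exact zsmul_mem (AddSubgroup.subset_closure (Set.mem_range_self i)) _
  refine ⟨(b : ℤ).natAbs, Int.natAbs_ne_zero.mpr (nonZeroDivisors.coe_ne_zero b), ?_⟩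
  rw [← natCast_zsmul]
  rcases Int.natAbs_eq (b : ℤ) with h | h
  · rwa [← h]
  · rw [← neg_eq_iff_eq_neg.mpr h, neg_smul]
    exact neg_mem hmem

theorem exists_le_range_latMap {M : AddSubgroup V} (hM : M.FG) {w : ι → V}
    (hw : Submodule.span ℚ (Set.range w) = ⊤) : ∃ N : ℕ, N ≠ 0 ∧ M ≤ (latMap N w).range := by
  obtain ⟨G, rfl⟩ := hM
  choose N hN hmem using exists_nsmul_mem_closure hw
  have hprod : ∏ α ∈ G, N α ≠ 0 := Finset.prod_ne_zero_iff.mpr fun α _ => hN α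
  refine ⟨_, hprod, (AddSubgroup.closure_le _).mpr fun α hα => ?_⟩
  obtain ⟨k, hk⟩ := Finset.dvd_prod_of_mem N hα
  rw [SetLike.mem_coe, mem_range_latMap hprod, hk, mul_comm, mul_nsmul']
  exact nsmul_mem (hmem α) _

end LatMap

section NatPoints

variable {σ : Type*}

/-- The inclusion of `ℕ ^ σ`, the exponents of power series, into `ℤ ^ σ`. -/
noncomputable def castHom (σ : Type*) : (σ →₀ ℕ) →+ (σ → ℤ) :=
  ((Nat.castAddMonoidHom ℤ).compLeft σ).comp Finsupp.coeFnAddHom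

@[simp] theorem castHom_apply (α : σ →₀ ℕ) (i : σ) : castHom σ α i = α i := rfl

theorem castHom_injective : Function.Injective (castHom σ) :=
  (Nat.cast_injective (R := ℤ)).comp_left.comp DFunLike.coe_injective

theorem exists_castHom_eq [Finite σ] {z : σ → ℤ} (hz : 0 ≤ z) : ∃ α, castHom σ α = z :=
  ⟨Finsupp.equivFunOnFinite.symm fun i => (z i).toNat,
    funext fun i => Int.toNat_of_nonneg (hz i)⟩

/-- The points of a subgroup of `ℤ ^ σ` with nonnegative coordinates. -/
noncomputable def natPoints (P : AddSubgroup (σ → ℤ)) : AddSubmonoid (σ →₀ ℕ) :=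
  P.toAddSubmonoid.comap (castHom σ)

theorem mem_natPoints {P : AddSubgroup (σ → ℤ)} {α : σ →₀ ℕ} :
    α ∈ natPoints P ↔ castHom σ α ∈ P := Iff.rfl

theorem isFull_natPoints (P : AddSubgroup (σ → ℤ)) : IsFull (natPoints P) := by
  intro α hα β hβ
  rw [mem_natPoints, map_add] at hβ
  exact (AddSubgroup.add_mem_cancel_left _ hα).mp hβ

theorem nsmul_mem_natPoints {P : AddSubgroup (σ → ℤ)} {N : ℕ} (hP : ∀ z, N • z ∈ P)
    (α : σ →₀ ℕ) : N • α ∈ natPoints P := by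
  rw [mem_natPoints, map_nsmul]
  exact hP _

end NatPoints

theorem exists_generator_of_bounded_denominators {H : AddSubgroup ℚ} (hH : H ≠ ⊥) {N : ℕ}
    (hN : N ≠ 0) (h : ∀ t ∈ H, ∃ z : ℤ, N * t = z) :
    ∃ r, 0 < r ∧ H = AddSubgroup.closure {r} := by
  have hN' : (0 : ℚ) < N := by positivity
  have hd : Disjoint (H : Set ℚ) (Set.Ioo 0 (N : ℚ)⁻¹) := by
    refine Set.disjoint_left.mpr fun t ht ⟨h0, h1⟩ => ?_
    obtain ⟨z, hz⟩ := h t ht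
    have hz0 : (0 : ℚ) < z := hz ▸ mul_pos hN' h0
    have hz1 : (z : ℚ) < 1 := hz ▸ (lt_inv_mul_iff₀ hN').mp (by simpa using h1)
    norm_cast at hz0 hz1
    omega
  obtain ⟨r, hr⟩ := AddSubgroup.exists_isLeast_pos hH (inv_pos.mpr hN') hd
  exact ⟨r, hr.1.2, AddSubgroup.cyclic_of_min hr⟩

section Cone

variable {n : ℕ} {M : AddSubgroup (Fin n → ℚ)} {v : Fin n → Fin n → ℤ}

theorem linearIndependent_cast_rat (hv : LinearIndependent ℝ fun i j => (v i j : ℝ)) :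
    LinearIndependent ℚ fun i j => (v i j : ℚ) := by
  refine .of_comp ((Algebra.linearMap ℚ ℝ).compLeft (Fin n)) ?_
  convert hv.restrict_scalars' ℚ using 1
  ext i j
  simp

theorem mem_cone_iff {x : Fin n → ℝ} :
    x ∈ cone v ↔ ∃ c : Fin n → ℝ, (∀ i, 0 ≤ c i) ∧ x = ∑ i, c i • fun j => (v i j : ℝ) := by
  rw [cone, PointedCone.hull, Submodule.mem_span_range_iff_exists_fun]
  constructor
  · rintro ⟨c, rfl⟩
    exact ⟨fun i => c i, fun i => (c i).2, rfl⟩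
  · rintro ⟨c, hc, rfl⟩
    exact ⟨fun i => ⟨c i, hc i⟩, rfl⟩

theorem latMap_mem_cone_iff (hv : LinearIndependent ℝ fun i j => (v i j : ℝ)) {N : ℕ}
    (hN : N ≠ 0) {r : Fin n → ℚ} (hr : ∀ i, 0 < r i) (z : Fin n → ℤ) :
    (fun j => (latMap N (fun i j => r i * (v i j : ℚ)) z j : ℝ)) ∈ cone v ↔ 0 ≤ z := by
  have hN' : (0 : ℝ) < N := by positivity
  have hr' (i) : (0 : ℝ) < r i := Rat.cast_pos.mpr (hr i)
  have hcoord : (fun j => (latMap N (fun i j => r i * (v i j : ℚ)) z j : ℝ)) =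
      ∑ i, (z i * (r i / N) : ℝ) • fun j => (v i j : ℝ) := by
    ext j
    simp only [latMap_apply, Pi.smul_apply, Finset.sum_apply, smul_eq_mul, Finset.mul_sum]
    push_cast
    exact Finset.sum_congr rfl fun i _ => by simp [zsmul_eq_mul]; ring
  have hnonneg (i) : (0 : ℝ) ≤ z i * (r i / N) ↔ 0 ≤ z i := by
    rw [mul_nonneg_iff_of_pos_right (div_pos (hr' i) hN'), Int.cast_nonneg_iff]
  rw [hcoord, mem_cone_iff]
  constructor
  · rintro ⟨c, hc, hzc⟩ i
    rw [Pi.zero_apply, ← hnonneg]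
    exact congrFun (hv.fintypeLinearCombination_injective hzc) i ▸ hc i
  · exact fun hz => ⟨_, fun i => (hnonneg i).mpr (hz i), rfl⟩

theorem nonempty_semigroup_equiv (hv : LinearIndependent ℝ fun i j => (v i j : ℝ)) {N : ℕ}
    (hN : N ≠ 0) {r : Fin n → ℚ} (hr : ∀ i, 0 < r i)
    (hM : M ≤ (latMap N fun i j => r i * (v i j : ℚ)).range) :
    Nonempty (semigroup M (cone v) ≃+
      natPoints (M.comap (latMap N fun i j => r i * (v i j : ℚ)))) := by
  set w : Fin n → Fin n → ℚ := fun i j => r i * (v i j : ℚ)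
  have hw : LinearIndependent ℚ w :=
    (linearIndependent_cast_rat hv).units_smul fun i => Units.mk0 (r i) (hr i).ne'
  let F : natPoints (M.comap (latMap N w)) →+ semigroup M (cone v) :=
    (((latMap N w).comp (castHom (Fin n))).comp (AddSubmonoid.subtype _)).codRestrict _ fun β =>
      ⟨β.2, (latMap_mem_cone_iff hv hN hr _).mpr fun i => Int.natCast_nonneg _⟩
  refine ⟨(AddEquiv.ofBijective F ⟨fun a b hab => ?_, fun ⟨α, hα, hcone⟩ => ?_⟩).symm⟩
  · exact Subtype.ext (castHom_injective (latMap_injective hN hw (congrArg Subtype.val hab)))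
  · obtain ⟨z, rfl⟩ := hM hα
    obtain ⟨β, rfl⟩ := exists_castHom_eq ((latMap_mem_cone_iff hv hN hr z).mp hcone)
    exact ⟨⟨β, hα⟩, rfl⟩

theorem exists_common_denominator (h : IsSimplicialPair M v) :
    ∃ N : ℕ, N ≠ 0 ∧ M ≤ (latMap N fun i j => (v i j : ℚ)).range :=
  exists_le_range_latMap h.fg <|
    (linearIndependent_cast_rat h.linearIndependent).span_eq_top_of_card_eq_finrank' (by simp)

theorem exists_ray_generator (h : IsSimplicialPair M v) (i : Fin n) :
    ∃ r : ℚ, 0 < r ∧ ∀ t : ℚ, (fun j => t * (v i j : ℚ)) ∈ M ↔ ∃ z : ℤ, t = z * r := by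
  obtain ⟨N, hN, hM⟩ := exists_common_denominator h
  have hN' : (N : ℚ) ≠ 0 := Nat.cast_ne_zero.mpr hN
  have hv := linearIndependent_cast_rat h.linearIndependent
  let H : AddSubgroup ℚ :=
    M.comap (LinearMap.toSpanSingleton ℚ _ fun j => (v i j : ℚ)).toAddMonoidHom
  have hH : H ≠ ⊥ := by
    refine (AddSubgroup.ne_bot_iff_exists_ne_zero).mpr ⟨⟨1, ?_⟩, Subtype.coe_ne_coe.mp one_ne_zero⟩
    simpa [H] using h.int_mem (v i)
  have hden (t : ℚ) (ht : t ∈ H) : ∃ z : ℤ, N * t = z := by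
    obtain ⟨z, hz⟩ := hM ht
    have hz' : Fintype.linearCombination ℚ (fun i j => (v i j : ℚ)) (fun k => (z k : ℚ)) =
        Fintype.linearCombination ℚ (fun i j => (v i j : ℚ)) (Pi.single i (N * t)) := by
      rw [Fintype.linearCombination_apply_single, mul_smul]
      rw [latMap_apply, inv_smul_eq_iff₀ hN'] at hz
      simpa [Fintype.linearCombination_apply, Int.cast_smul_eq_zsmul] using hz
    exact ⟨z i, by simpa using (congrFun (hv.fintypeLinearCombination_injective hz') i).symm⟩
  obtain ⟨r, hr, hHr⟩ := exists_generator_of_bounded_denominators hH hN hden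
  refine ⟨r, hr, fun t => ?_⟩
  change t ∈ H ↔ _
  simp [hHr, AddSubgroup.mem_closure_singleton, eq_comm]

theorem exists_ray_generators (h : IsSimplicialPair M v) :
    ∃ r : Fin n → ℚ, (∀ i, 0 < r i) ∧
      ∀ i (t : ℚ), (fun j => t * (v i j : ℚ)) ∈ M ↔ ∃ z : ℤ, t = z * r i := by
  choose r hr hmem using exists_ray_generator h
  exact ⟨r, hr, hmem⟩

theorem le_range_latMap_relIndex (hk : (rayLattice M v).relIndex M ≠ 0) {r : Fin n → ℚ}
    (hr : ∀ i (t : ℚ), (fun j => t * (v i j : ℚ)) ∈ M → ∃ z : ℤ, t = z * r i) :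
    M ≤ (latMap ((rayLattice M v).relIndex M) fun i j => r i * (v i j : ℚ)).range := by
  have hle : rayLattice M v ≤
      AddSubgroup.closure (Set.range fun i j => r i * (v i j : ℚ)) := by
    refine (AddSubgroup.closure_le _).mpr ?_
    rintro α ⟨hα, i, t, rfl⟩
    obtain ⟨z, rfl⟩ := hr i t hα
    have hmul : (fun j => z * r i * (v i j : ℚ)) = z • fun j => r i * (v i j : ℚ) := by
      ext j
      simp [mul_assoc]
    exact hmul ▸ zsmul_mem (AddSubgroup.subset_closure (Set.mem_range_self i)) z
  intro α hα
  exact (mem_range_latMap hk).mpr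
    (hle (AddSubgroup.nsmul_index_mem ((rayLattice M v).addSubgroupOf M) ⟨α, hα⟩))

end Cone

end Lattice

/-! ### Normalizations and radical extensions -/

section Normalization

theorem eq_minpoly_of_irreducible {A C : Type*} [CommRing A] [IsDomain A] [IsIntegrallyClosed A]
    [CommRing C] [IsDomain C] [Algebra A C] [Module.IsTorsionFree A C] {f : A[X]} (hf : f.Monic)
    (hirr : Irreducible f) {ξ : C} (hξ : aeval ξ f = 0) : f = minpoly A ξ := by
  have hint : IsIntegral A ξ := ⟨f, hf, hξ⟩
  have hassoc : Associated f (minpoly A ξ) :=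
    (hirr.dvd_iff.mp (minpoly.isIntegrallyClosed_dvd hint hξ)).resolve_left
      (minpoly.not_isUnit A ξ)
  exact eq_of_monic_of_associated hf (minpoly.monic hint) hassoc

section IsIntegral

attribute [local instance] FractionRing.liftAlgebra

variable {K B C : Type*} [CommRing B] [IsDomain B] [CommRing C] [IsDomain C]
  [IsIntegrallyClosed C] [Algebra B C] [FaithfulSMul B C] [Algebra.IsIntegral B C]

variable (C) in
theorem isIntegral_fractionRing_iff {x : FractionRing B} :
    IsIntegral B x ↔ ∃ c, algebraMap C (FractionRing C) c = algebraMap _ (FractionRing C) x := by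
  rw [← isIntegral_algebraMap_iff (algebraMap (FractionRing B) (FractionRing C)).injective,
    ← IsIntegrallyClosed.isIntegral_iff]
  exact ⟨fun h => h.tower_top, isIntegral_trans _⟩

theorem nonempty_normalization_equiv_of_isIntegral [CommRing K] [Algebra K B] [Algebra K C]
    [IsScalarTower K B C] {s : Set C} (hs : (algebraMap B C).range = Subring.closure s)
    (W : Subalgebra K C)
    (hW : ∀ θ, θ ∈ W ↔
      algebraMap C (FractionRing C) θ ∈ Subfield.closure (algebraMap C (FractionRing C) '' s)) :
    Nonempty (Normalization B ≃ₐ[K] W) := by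
  have : IsScalarTower K B (FractionRing C) := .of_algebraMap_eq fun r => by
    rw [IsScalarTower.algebraMap_apply B C, ← IsScalarTower.algebraMap_apply K B C,
      ← IsScalarTower.algebraMap_apply K C]
  have hfield : (algebraMap (FractionRing B) (FractionRing C)).fieldRange =
      Subfield.closure (algebraMap C (FractionRing C) '' s) := by
    refine IsFractionRing.ringHom_fieldRange_eq_of_comp_eq_of_range_eq
      (g := (algebraMap C (FractionRing C)).comp (algebraMap B C)) ?_ ?_
    · rw [← IsScalarTower.algebraMap_eq, ← IsScalarTower.algebraMap_eq]
    · rw [← RingHom.map_range, hs, RingHom.map_closure]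
  let j : Normalization B →ₐ[K] FractionRing C :=
    ((IsScalarTower.toAlgHom B (FractionRing B) (FractionRing C)).comp
      (integralClosure B (FractionRing B)).val).restrictScalars K
  have hj : Function.Injective j :=
    (algebraMap (FractionRing B) (FractionRing C)).injective.comp Subtype.val_injective
  let i : W →ₐ[K] FractionRing C := (IsScalarTower.toAlgHom K C (FractionRing C)).comp W.val
  have hi : Function.Injective i :=
    (IsFractionRing.injective C (FractionRing C)).comp Subtype.val_injective
  have hrange : j.range = i.range := by
    apply le_antisymm
    · rintro _ ⟨⟨x, hx⟩, rfl⟩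
      obtain ⟨c, hc⟩ := (isIntegral_fractionRing_iff C).mp hx
      refine ⟨⟨c, (hW c).mpr ?_⟩, hc⟩
      rw [hc, ← hfield]
      exact ⟨x, rfl⟩
    · rintro _ ⟨⟨θ, hθ⟩, rfl⟩
      obtain ⟨x, hx⟩ := hfield ▸ (hW θ).mp hθ
      exact ⟨⟨x, (isIntegral_fractionRing_iff C).mpr ⟨θ, hx.symm⟩⟩, hx⟩
  exact ⟨(AlgEquiv.ofInjective j hj).trans
    ((Subalgebra.equivOfEq _ _ hrange).trans (AlgEquiv.ofInjective i hi).symm)⟩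

end IsIntegral

/-- The subfield `Frac(A)(s)` of the fraction field of the extension `C` of `A` along `φ`. -/
noncomputable def genField {A C : Type*} [CommRing A] [CommRing C] [IsDomain C] (φ : A →+* C)
    (s : Set C) : Subfield (FractionRing C) :=
  Subfield.closure (algebraMap C (FractionRing C) '' (Set.range φ ∪ s))

variable {K A C : Type*} [CommRing A] [CommRing C] [IsDomain C]

theorem algebraMap_mem_genField (φ : A →+* C) (s : Set C) (a : A) :
    algebraMap C (FractionRing C) (φ a) ∈ genField φ s :=
  Subfield.subset_closure ⟨φ a, .inl ⟨a, rfl⟩, rfl⟩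

theorem mem_genField_of_mem (φ : A →+* C) {s : Set C} {x : C} (hx : x ∈ s) :
    algebraMap C (FractionRing C) x ∈ genField φ s :=
  Subfield.subset_closure ⟨x, .inr hx, rfl⟩

theorem nonempty_normalization_equiv [CommRing K] [Algebra K A] [Algebra K C] [IsDomain A]
    [IsIntegrallyClosed A] [IsIntegrallyClosed C] (φ : A →ₐ[K] C) (hφ : Function.Injective φ)
    (hint : φ.toRingHom.IsIntegral) {f : A[X]} (hf : f.Monic) (hirr : Irreducible f) {ξ : C}
    (hξ : f.eval₂ φ.toRingHom ξ = 0) (W : Subalgebra K C)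
    (hW : ∀ θ, θ ∈ W ↔ algebraMap C (FractionRing C) θ ∈ genField φ.toRingHom {ξ}) :
    IsDomain (AdjoinRoot f) ∧ Nonempty (Normalization (AdjoinRoot f) ≃ₐ[K] W) := by
  let _ : Algebra A C := φ.toRingHom.toAlgebra
  have : IsScalarTower K A C := .of_algebraMap_eq fun r => (φ.commutes r).symm
  have : FaithfulSMul A C := (faithfulSMul_iff_algebraMap_injective A C).mpr hφ
  have : Algebra.IsIntegral A C := algebraMap_isIntegral_iff.mp hint
  obtain rfl := eq_minpoly_of_irreducible hf hirr (ξ := ξ) hξ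
  let ψ : AdjoinRoot (minpoly A ξ) →ₐ[A] C :=
    (Algebra.adjoin A {ξ}).val.comp
      (minpoly.equivAdjoin (R := A) (Algebra.IsIntegral.isIntegral ξ)).toAlgHom
  have hψ : Function.Injective ψ := Subtype.val_injective.comp (AlgEquiv.injective _)
  have hrange : ψ.range = Algebra.adjoin A {ξ} := by
    rw [AlgHom.range_comp, (AlgHom.range_eq_top _).mpr (AlgEquiv.surjective _), Algebra.map_top,
      Subalgebra.range_val]
  have hdom : IsDomain (AdjoinRoot (minpoly A ξ)) := hψ.isDomain ψ.toRingHom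
  refine ⟨hdom, ?_⟩
  let _ : Algebra (AdjoinRoot (minpoly A ξ)) C := ψ.toRingHom.toAlgebra
  have : FaithfulSMul (AdjoinRoot (minpoly A ξ)) C :=
    (faithfulSMul_iff_algebraMap_injective _ _).mpr hψ
  have : IsScalarTower A (AdjoinRoot (minpoly A ξ)) C :=
    .of_algebraMap_eq fun a => (ψ.commutes a).symm
  have : IsScalarTower K (AdjoinRoot (minpoly A ξ)) C := .to₁₃₄ K A _ C
  have : Algebra.IsIntegral (AdjoinRoot (minpoly A ξ)) C := .tower_top A
  refine nonempty_normalization_equiv_of_isIntegral (s := Set.range φ ∪ {ξ}) ?_ W hW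
  exact (congrArg Subalgebra.toSubring hrange).trans (Algebra.adjoin_eq_ring_closure {ξ})

end Normalization

section Kummer

variable {E Ω : Type*} [Field E] [Field Ω] [Algebra E Ω] {m : ℕ} [NeZero m] {ζ : E}

theorem isSeparable_of_pow_mem_range (hζ : IsPrimitiveRoot ζ m) {x : Ω}
    (hx : x ^ m ∈ (algebraMap E Ω).range) : IsSeparable E x := by
  have := hζ.neZero'
  rcases eq_or_ne x 0 with rfl | hx0
  · simpa using isSeparable_algebraMap (F := E) (K := Ω) 0
  obtain ⟨e, he⟩ := hx
  have he0 : e ≠ 0 := by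
    rintro rfl
    exact pow_ne_zero m hx0 (by rw [← he, map_zero])
  exact (separable_X_pow_sub_C e (NeZero.ne (m : E)) he0).of_dvd
    (minpoly.dvd E x (p := X ^ m - C e) (by simp [he]))

theorem minpoly_splits_of_pow_mem_range (hζ : IsPrimitiveRoot ζ m) {x : Ω}
    (hx : x ^ m ∈ (algebraMap E Ω).range) : ((minpoly E x).map (algebraMap E Ω)).Splits := by
  obtain ⟨e, he⟩ := hx
  have hsplits : ((X ^ m - C e).map (algebraMap E Ω)).Splits := by
    rw [Polynomial.map_sub, Polynomial.map_pow, map_X, map_C]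
    exact X_pow_sub_C_splits_of_isPrimitiveRoot (hζ.map_of_injective (algebraMap E Ω).injective)
      he.symm
  exact hsplits.of_dvd (Polynomial.map_ne_zero (X_pow_sub_C_ne_zero (NeZero.pos m) _))
    (Polynomial.map_dvd _ (minpoly.dvd E x (by simp [he])))

theorem isGalois_of_adjoin_radicals_eq_top (hζ : IsPrimitiveRoot ζ m) {s : Set Ω}
    (hs : ∀ x ∈ s, x ^ m ∈ (algebraMap E Ω).range)
    (htop : IntermediateField.adjoin E s = ⊤) : IsGalois E Ω := by
  have hsep : Algebra.IsSeparable E (IntermediateField.adjoin E s) :=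
    (IntermediateField.isSeparable_adjoin_iff_isSeparable E Ω).mpr fun x hx =>
      isSeparable_of_pow_mem_range hζ (hs x hx)
  rw [htop] at hsep
  have : Algebra.IsSeparable E Ω :=
    .of_algHom E _ (IntermediateField.topEquiv (F := E)).symm.toAlgHom
  have : Normal E Ω := by
    refine normal_iff.mpr fun x => ⟨Algebra.IsSeparable.isIntegral E x, ?_⟩
    refine IntermediateField.splits_of_mem_adjoin E Ω (S := s) (fun y hy => ?_) (htop ▸ trivial)
    exact ⟨Algebra.IsSeparable.isIntegral E y, minpoly_splits_of_pow_mem_range hζ (hs y hy)⟩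
  constructor

theorem exists_apply_eq_mul_of_pow_mem_range (hζ : IsPrimitiveRoot ζ m) {x : Ω}
    (hx : x ^ m ∈ (algebraMap E Ω).range) (σ : Ω ≃ₐ[E] Ω) :
    ∃ c : E, σ x = algebraMap E Ω c * x := by
  rcases eq_or_ne x 0 with rfl | hx0
  · exact ⟨1, by simp⟩
  have hpow : (σ x / x) ^ m = 1 := by
    obtain ⟨e, he⟩ := hx
    rw [div_pow, ← map_pow, ← he, σ.commutes, he, div_self (pow_ne_zero _ hx0)]
  obtain ⟨k, -, hk⟩ :=
    (hζ.map_of_injective (algebraMap E Ω).injective).eq_pow_of_pow_eq_one hpow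
  exact ⟨ζ ^ k, by rw [map_pow, hk, div_mul_cancel₀ _ hx0]⟩

/- An automorphism fixing `L` scales each radical by a root of unity in `E`; comparing coefficients,
it fixes every radical that occurs in an element of `L`. -/
theorem radical_mem_of_sum_mem [IsGalois E Ω] [FiniteDimensional E Ω] {B : Type*} [Fintype B]
    (hζ : IsPrimitiveRoot ζ m) {μ : B → Ω} (hμ : ∀ b, μ b ^ m ∈ (algebraMap E Ω).range)
    (hli : LinearIndependent E μ) (L : IntermediateField E Ω) {c : B → E}
    (hL : ∑ b, c b • μ b ∈ L) {b : B} (hb : c b ≠ 0) : μ b ∈ L := by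
  rw [← IsGalois.fixedField_fixingSubgroup L, IntermediateField.mem_fixedField_iff]
  intro σ hσ
  choose d hd using fun b => exists_apply_eq_mul_of_pow_mem_range hζ (hμ b) σ
  have hfix : ∑ b, (c b * d b) • μ b = ∑ b, c b • μ b := by
    rw [← (IntermediateField.mem_fixingSubgroup_iff L σ).mp hσ _ hL, map_sum]
    exact Finset.sum_congr rfl fun b _ => by rw [map_smul, hd, mul_smul, Algebra.smul_def (d b)]
  have hcoeff : c b * d b = c b := congrFun (hli.fintypeLinearCombination_injective hfix) b
  rw [hd, mul_eq_left₀ hb |>.mp hcoeff, map_one, one_mul]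

end Kummer

section RadicalBasis

/-- A basis `μ` of `C` over `A`, along `φ`, consisting of `m`-th roots of elements of `A`. -/
structure IsRadicalBasis {A C B : Type*} [CommRing A] [CommRing C] [Fintype B] (φ : A →+* C)
    (m : ℕ) (μ : B → C) : Prop where
  pow_mem : ∀ b, μ b ^ m ∈ φ.range
  bijective : Function.Bijective fun c : B → A => ∑ b, φ (c b) * μ b

theorem isIntegral_of_surjective {A C B : Type*} [CommRing A] [CommRing C] [Fintype B]
    {φ : A →+* C} {μ : B → C}
    (h : Function.Surjective fun c : B → A => ∑ b, φ (c b) * μ b) : φ.IsIntegral := by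
  let _ := φ.toAlgebra
  have : Module.Finite A C := .of_surjective (Fintype.linearCombination A μ) fun θ => by
    obtain ⟨c, hc⟩ := h θ
    exact ⟨c, by simpa only [Fintype.linearCombination_apply, Algebra.smul_def] using! hc⟩
  exact algebraMap_isIntegral_iff.mpr inferInstance

variable {A C B : Type*} [CommRing A] [CommRing C] [Fintype B] {m : ℕ} {μ : B → C}

theorem IsRadicalBasis.isIntegral {φ : A →+* C} (h : IsRadicalBasis φ m μ) : φ.IsIntegral :=
  isIntegral_of_surjective h.bijective.surjective

section Algebra

variable [Algebra A C]

/-- A radical basis as a basis in the sense of linear algebra. -/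
noncomputable def IsRadicalBasis.basis (h : IsRadicalBasis (algebraMap A C) m μ) :
    Module.Basis B A C :=
  .ofEquivFun (LinearEquiv.ofBijective (Fintype.linearCombination A μ) (by
    simpa only [← Algebra.smul_def] using! h.bijective)).symm

theorem IsRadicalBasis.basis_apply (h : IsRadicalBasis (algebraMap A C) m μ) (b : B) :
    h.basis b = μ b := by
  classical
  rw [basis, Module.Basis.coe_ofEquivFun, LinearEquiv.symm_symm]
  exact (Fintype.linearCombination_apply_single A μ b 1).trans (one_smul A _)

attribute [local instance] FractionRing.liftAlgebra

variable [IsDomain C] [FaithfulSMul A C]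

theorem IsRadicalBasis.algebraMap_pow_mem (h : IsRadicalBasis (algebraMap A C) m μ) (b : B) :
    algebraMap C (FractionRing C) (μ b) ^ m ∈
      (algebraMap (FractionRing A) (FractionRing C)).range := by
  obtain ⟨a, ha⟩ := h.pow_mem b
  exact ⟨algebraMap A _ a, by
    rw [← map_pow, ← ha, ← IsScalarTower.algebraMap_apply, ← IsScalarTower.algebraMap_apply]⟩

variable [IsDomain A]

theorem algebraMap_mem_of_forall_mem {L : Subfield (FractionRing C)}
    (hL : ∀ a, algebraMap C (FractionRing C) (algebraMap A C a) ∈ L) (e : FractionRing A) :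
    algebraMap (FractionRing A) (FractionRing C) e ∈ L := by
  obtain ⟨x, y, -, rfl⟩ := IsFractionRing.div_surjective (A := A) e
  rw [map_div₀, ← IsScalarTower.algebraMap_apply, ← IsScalarTower.algebraMap_apply,
    IsScalarTower.algebraMap_apply A C, IsScalarTower.algebraMap_apply A C]
  exact L.div_mem (hL x) (hL y)

theorem toSubfield_adjoin (s : Set C) :
    (IntermediateField.adjoin (FractionRing A) (algebraMap C (FractionRing C) '' s)).toSubfield =
      genField (algebraMap A C) s := by
  apply le_antisymm
  · have hle : IntermediateField.adjoin (FractionRing A) (algebraMap C (FractionRing C) '' s) ≤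
        (genField (algebraMap A C) s).toIntermediateField
          (algebraMap_mem_of_forall_mem (algebraMap_mem_genField _ s)) := by
      rw [IntermediateField.adjoin_le_iff]
      rintro _ ⟨x, hx, rfl⟩
      exact mem_genField_of_mem _ hx
    exact hle
  · rw [genField, Subfield.closure_le]
    rintro _ ⟨_, ⟨a, rfl⟩ | hx, rfl⟩
    · rw [← IsScalarTower.algebraMap_apply A C,
        IsScalarTower.algebraMap_apply A (FractionRing A) (FractionRing C)]
      exact IntermediateField.algebraMap_mem _ _
    · exact IntermediateField.subset_adjoin _ _ ⟨_, hx, rfl⟩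

/-- A radical basis as a basis of the extension of fraction fields. -/
noncomputable def IsRadicalBasis.fractionBasis [Algebra.IsIntegral A C]
    (h : IsRadicalBasis (algebraMap A C) m μ) :
    Module.Basis B (FractionRing A) (FractionRing C) :=
  h.basis.localizationLocalization (FractionRing A) (nonZeroDivisors A) (FractionRing C)

theorem IsRadicalBasis.fractionBasis_apply [Algebra.IsIntegral A C]
    (h : IsRadicalBasis (algebraMap A C) m μ) (b : B) :
    h.fractionBasis b = algebraMap C (FractionRing C) (μ b) := by
  rw [fractionBasis, Module.Basis.localizationLocalization_apply, h.basis_apply]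

theorem IsRadicalBasis.isGalois [Algebra.IsIntegral A C] [NeZero m] {ζ : A}
    (hζ : IsPrimitiveRoot ζ m) (h : IsRadicalBasis (algebraMap A C) m μ) :
    IsGalois (FractionRing A) (FractionRing C) := by
  refine isGalois_of_adjoin_radicals_eq_top
    (hζ.map_of_injective (IsFractionRing.injective A (FractionRing A)))
    (s := Set.range h.fractionBasis) ?_ ?_
  · rintro _ ⟨b, rfl⟩
    rw [h.fractionBasis_apply]
    exact h.algebraMap_pow_mem b
  · refine IntermediateField.toSubalgebra_injective (Algebra.toSubmodule_eq_top.mp ?_)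
    rw [eq_top_iff, ← h.fractionBasis.span_eq, Submodule.span_le]
    exact IntermediateField.subset_adjoin _ _

theorem exists_adjoin_simple_algebraMap_eq [IsIntegrallyClosed C] [Algebra.IsIntegral A C]
    (α : FractionRing C) : ∃ ξ : C,
      IntermediateField.adjoin (FractionRing A) {algebraMap C (FractionRing C) ξ} =
        IntermediateField.adjoin (FractionRing A) {α} := by
  have halg : IsAlgebraic A α :=
    (IsFractionRing.isAlgebraic_iff A (FractionRing A) (FractionRing C)).mpr
      (Algebra.IsAlgebraic.isAlgebraic α)
  obtain ⟨a, ha, hint⟩ := halg.exists_integral_multiple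
  obtain ⟨ξ, hξ⟩ := IsIntegrallyClosed.isIntegral_iff.mp (hint.tower_top (A := C))
  have ha0 : algebraMap A (FractionRing A) a ≠ 0 := by simpa using ha
  have hsmul : algebraMap C (FractionRing C) ξ = algebraMap A (FractionRing A) a • α := by
    rw [hξ, algebraMap_smul]
  refine ⟨ξ, le_antisymm ?_ ?_⟩ <;> rw [IntermediateField.adjoin_simple_le_iff]
  · rw [hsmul]
    exact IntermediateField.smul_mem _ (IntermediateField.mem_adjoin_simple_self _ _)
  · rw [← inv_smul_smul₀ ha0 α, ← hsmul]
    exact IntermediateField.smul_mem _ (IntermediateField.mem_adjoin_simple_self _ _)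

theorem minpoly_algebraMap_eq_map [IsIntegrallyClosed A] {f : A[X]} (hf : f.Monic)
    (hirr : Irreducible f) {ξ : C} (hξ : aeval ξ f = 0) :
    minpoly (FractionRing A) (algebraMap C (FractionRing C) ξ) = f.map (algebraMap A _) := by
  have hroot : aeval (algebraMap C (FractionRing C) ξ) f = 0 := by
    rw [aeval_algebraMap_apply, hξ, map_zero]
  rw [minpoly.isIntegrallyClosed_eq_field_fractions' (FractionRing A) ⟨f, hf, hroot⟩,
    ← eq_minpoly_of_irreducible hf hirr hroot]

end Algebra

section Hom

attribute [local instance] FractionRing.liftAlgebra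

variable [IsDomain A] [IsDomain C] {φ : A →+* C}

theorem IsRadicalBasis.natDegree_dvd [IsIntegrallyClosed A] (hφ : Function.Injective φ)
    (h : IsRadicalBasis φ m μ) {f : A[X]} (hf : f.Monic) (hirr : Irreducible f) {ξ : C}
    (hξ : f.eval₂ φ ξ = 0) : f.natDegree ∣ Fintype.card B := by
  let _ : Algebra A C := φ.toAlgebra
  have : FaithfulSMul A C := (faithfulSMul_iff_algebraMap_injective A C).mpr hφ
  have : Algebra.IsIntegral A C := algebraMap_isIntegral_iff.mp h.isIntegral
  have : FiniteDimensional (FractionRing A) (FractionRing C) :=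
    h.fractionBasis.finiteDimensional_of_finite
  have hdvd := minpoly.degree_dvd
    (IsIntegral.of_finite (FractionRing A) (algebraMap C (FractionRing C) ξ))
  rwa [minpoly_algebraMap_eq_map hf hirr (ξ := ξ) hξ,
    Module.finrank_eq_card_basis h.fractionBasis, hf.natDegree_map] at hdvd

variable [NeZero m] {ζ : A}

theorem IsRadicalBasis.exists_primitive [IsIntegrallyClosed C] (hφ : Function.Injective φ)
    (hζ : IsPrimitiveRoot ζ m) (h : IsRadicalBasis φ m μ) (L : Subfield (FractionRing C))
    (hL : ∀ a, algebraMap C (FractionRing C) (φ a) ∈ L) : ∃ ξ : C, genField φ {ξ} = L := by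
  let _ : Algebra A C := φ.toAlgebra
  have : FaithfulSMul A C := (faithfulSMul_iff_algebraMap_injective A C).mpr hφ
  have : Algebra.IsIntegral A C := algebraMap_isIntegral_iff.mp h.isIntegral
  have := h.isGalois hζ
  have : FiniteDimensional (FractionRing A) (FractionRing C) :=
    h.fractionBasis.finiteDimensional_of_finite
  have : Finite (IntermediateField (FractionRing A) (FractionRing C)) :=
    Field.finite_intermediateField_of_exists_primitive_element _ _
      (Field.exists_primitive_element _ _)
  obtain ⟨α, hα⟩ := Field.exists_primitive_element_of_finite_intermediateField _ _
    (L.toIntermediateField (algebraMap_mem_of_forall_mem hL))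
  obtain ⟨ξ, hξ⟩ := exists_adjoin_simple_algebraMap_eq (A := A) α
  refine ⟨ξ, (toSubfield_adjoin (A := A) {ξ}).symm.trans ?_⟩
  rw [Set.image_singleton, hξ, hα, Subfield.toIntermediateField_toSubfield]

theorem IsRadicalBasis.mem_of_sum_mem (hφ : Function.Injective φ) (hζ : IsPrimitiveRoot ζ m)
    (h : IsRadicalBasis φ m μ) (L : Subfield (FractionRing C))
    (hL : ∀ a, algebraMap C (FractionRing C) (φ a) ∈ L) (c : B → A)
    (hc : algebraMap C (FractionRing C) (∑ b, φ (c b) * μ b) ∈ L) {b : B} (hb : c b ≠ 0) :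
    algebraMap C (FractionRing C) (μ b) ∈ L := by
  let _ : Algebra A C := φ.toAlgebra
  have : FaithfulSMul A C := (faithfulSMul_iff_algebraMap_injective A C).mpr hφ
  have : Algebra.IsIntegral A C := algebraMap_isIntegral_iff.mp h.isIntegral
  have := h.isGalois hζ
  have : FiniteDimensional (FractionRing A) (FractionRing C) :=
    h.fractionBasis.finiteDimensional_of_finite
  have hsum : algebraMap C (FractionRing C) (∑ b, φ (c b) * μ b) =
      ∑ b, algebraMap A (FractionRing A) (c b) • h.fractionBasis b := by
    refine (map_sum _ _ _).trans (Finset.sum_congr rfl fun b _ => ?_)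
    rw [h.fractionBasis_apply, algebraMap_smul, map_mul, Algebra.smul_def,
      IsScalarTower.algebraMap_apply A C]
    rfl
  rw [← h.fractionBasis_apply]
  refine radical_mem_of_sum_mem
    (hζ.map_of_injective (IsFractionRing.injective A (FractionRing A))) (fun b => ?_)
    h.fractionBasis.linearIndependent
    (L.toIntermediateField (algebraMap_mem_of_forall_mem hL))
    (c := fun b => algebraMap A (FractionRing A) (c b)) (hsum ▸ hc) (by simpa using hb)
  rw [h.fractionBasis_apply]
  exact h.algebraMap_pow_mem b

theorem IsRadicalBasis.splits [IsIntegrallyClosed A] [IsIntegrallyClosed C]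
    (hφ : Function.Injective φ) (hζ : IsPrimitiveRoot ζ m) (h : IsRadicalBasis φ m μ)
    {f : A[X]} (hf : f.Monic) (hirr : Irreducible f) {ξ : C} (hξ : f.eval₂ φ ξ = 0) :
    (f.map φ).Splits := by
  let _ : Algebra A C := φ.toAlgebra
  have : FaithfulSMul A C := (faithfulSMul_iff_algebraMap_injective A C).mpr hφ
  have : Algebra.IsIntegral A C := algebraMap_isIntegral_iff.mp h.isIntegral
  have := h.isGalois hζ
  have hcomp : (algebraMap (FractionRing A) (FractionRing C)).comp (algebraMap A (FractionRing A)) =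
      (algebraMap C (FractionRing C)).comp φ := by
    rw [← IsScalarTower.algebraMap_eq, IsScalarTower.algebraMap_eq A C (FractionRing C)]
    rfl
  have hsplits := IsGalois.splits (FractionRing A) (algebraMap C (FractionRing C) ξ)
  rw [minpoly_algebraMap_eq_map hf hirr (ξ := ξ) hξ, Polynomial.map_map, hcomp,
    ← Polynomial.map_map] at hsplits
  refine hsplits.of_splits_map_of_injective (IsFractionRing.injective C (FractionRing C))
    fun x hx => IsIntegrallyClosed.isIntegral_iff.mp ⟨f.map φ, hf.map _, ?_⟩
  rw [← eval_map]
  exact isRoot_of_mem_roots hx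

end Hom

end RadicalBasis

/-! ### Roots of Puiseux polynomials -/

section Expand

open MvPowerSeries

variable {σ R : Type*} [CommRing R] {N : ℕ}

theorem expand_injective [Finite σ] (hN : N ≠ 0) :
    Function.Injective (MvPowerSeries.expand (R := R) (σ := σ) N hN) := by
  rw [← twist_one]
  exact twist_injective hN fun _ => map_one _

theorem expand_mem_supported [Finite σ] (hN : N ≠ 0) {T : AddSubmonoid (σ →₀ ℕ)}
    (hNT : ∀ α, N • α ∈ T) (g : MvPowerSeries σ R) :
    MvPowerSeries.expand N hN g ∈ supported R T := by
  rw [← twist_one]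
  exact twist_mem hN hNT (fun _ => one_mem _) g

theorem coeff_expand_mul_monomial [Finite σ] [DecidableEq (σ → Fin N)] (hN : N ≠ 0)
    (g : MvPowerSeries σ R) (β β' : σ → Fin N) (γ : σ →₀ ℕ) :
    coeff (boxExp β + N • γ) (MvPowerSeries.expand N hN g * monomial (boxExp β') 1) =
      if β' = β then coeff γ g else 0 := by
  rw [MvPowerSeries.coeff_mul_monomial, mul_one]
  split_ifs with hle heq heq
  · rw [heq, add_tsub_cancel_left, coeff_expand_smul]
  · obtain ⟨i, hi⟩ := Function.ne_iff.mp heq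
    refine coeff_expand_of_not_dvd N hN g (i := i) fun ⟨k, hk⟩ => hi ?_
    have hlei := hle i
    simp only [Finsupp.coe_tsub, Pi.sub_apply, Finsupp.coe_add, Pi.add_apply, boxExp_apply,
      Finsupp.coe_smul, Pi.smul_apply, smul_eq_mul] at hk hlei
    have hmod : (β i + N * γ i) % N = (β' i + N * k) % N := by congr 1; omega
    rw [Nat.add_mul_mod_self_left, Nat.add_mul_mod_self_left, Nat.mod_eq_of_lt (β i).2,
      Nat.mod_eq_of_lt (β' i).2] at hmod
    exact Fin.ext hmod.symm
  · subst heq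
    exact absurd (self_le_add_right _ _) hle
  · rfl

theorem surjective_sum_twist_mul [Fintype σ] [DecidableEq σ] (hN : N ≠ 0)
    {u : σ → MvPowerSeries σ R} (hu : ∀ i, constantCoeff (u i) = 1) :
    Function.Surjective fun c : (σ → Fin N) → MvPowerSeries σ R =>
      ∑ β, twist hN u (c β) * MvPowerSeries.monomial (boxExp β) 1 := fun θ => by
  obtain ⟨h, -, hh⟩ := exists_eq_sum_twist (T := ⊤) hN isFull_top (fun _ => trivial)
    (fun _ => mem_supported_top _) hu (mem_supported_top θ)
  exact ⟨h, (hh.trans (Finset.sum_congr rfl fun β _ => mul_comm _ _)).symm⟩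

theorem isIntegral_twist [Finite σ] (hN : N ≠ 0) {u : σ → MvPowerSeries σ R}
    (hu : ∀ i, constantCoeff (u i) = 1) : (twist hN u).toRingHom.IsIntegral := by
  classical
  have := Fintype.ofFinite σ
  exact isIntegral_of_surjective (surjective_sum_twist_mul hN hu)

theorem isRadicalBasis_expand [Fintype σ] [DecidableEq σ] (hN : N ≠ 0) :
    IsRadicalBasis (MvPowerSeries.expand (R := R) (σ := σ) N hN).toRingHom N
      fun β : σ → Fin N => monomial (boxExp β) 1 where
  pow_mem β := ⟨monomial (boxExp β) 1, by
    change MvPowerSeries.expand N hN _ = _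
    rw [MvPowerSeries.expand_monomial, MvPowerSeries.monomial_pow, one_pow]⟩
  bijective := by
    refine ⟨fun c c' h => ?_, ?_⟩
    · have hcoeff (c : (σ → Fin N) → MvPowerSeries σ R) (β : σ → Fin N) (γ : σ →₀ ℕ) :
          coeff (boxExp β + N • γ) (∑ b, MvPowerSeries.expand N hN (c b) *
            MvPowerSeries.monomial (boxExp b) 1) = coeff γ (c β) := by
        rw [map_sum, Finset.sum_congr rfl fun b _ => coeff_expand_mul_monomial hN (c b) β b γ,
          Finset.sum_ite_eq' Finset.univ β, if_pos (Finset.mem_univ β)]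
      ext β γ
      rw [← hcoeff c, ← hcoeff c']
      exact congrArg _ h
    · have h := surjective_sum_twist_mul (R := R) (σ := σ) hN (u := fun _ => 1) fun _ => map_one _
      rwa [twist_one] at h

theorem isPuiseux_of_splits {K : Type*} [Field K] {n : ℕ} {f : (MvPowerSeries (Fin n) K)[X]}
    (hf : f.Monic) (hN : N ≠ 0)
    (h : (f.map (MvPowerSeries.expand (R := K) (σ := Fin n) N hN).toRingHom).Splits) :
    IsPuiseux f := by
  set g := f.map (MvPowerSeries.expand (R := K) (σ := Fin n) N hN).toRingHom
  refine ⟨hf, N, hN, _, g.roots.toList.get, ?_⟩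
  calc g = (g.roots.map fun a => Polynomial.X - Polynomial.C a).prod :=
        h.eq_prod_roots_of_monic (hf.map _)
    _ = (g.roots.toList.map fun a => Polynomial.X - Polynomial.C a).prod := by
        rw [← Multiset.prod_coe, ← Multiset.map_coe, Multiset.coe_toList]
    _ = ∏ i, (Polynomial.X - Polynomial.C (g.roots.toList.get i)) := by
        conv_lhs => rw [← List.ofFn_get g.roots.toList, List.map_ofFn]
        rw [← List.prod_ofFn, Function.comp_def]

end Expand

section SupportedField

open MvPowerSeries

theorem exists_mul_eq_of_mem_genField {A C : Type*} [CommRing A] [CommRing C] [IsDomain C]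
    {φ : A →+* C} {s : Set C} {W : Subring C} (hφ : ∀ a, φ a ∈ W) (hs : s ⊆ W) {θ : C}
    (h : algebraMap C (FractionRing C) θ ∈ genField φ s) : ∃ b ∈ W, b ≠ 0 ∧ b * θ ∈ W := by
  obtain ⟨y, hy, z, hz, hyz⟩ := Subfield.mem_closure_iff.mp h
  have hle : Subring.closure (Set.range φ ∪ s) ≤ W := by
    rw [Subring.closure_le]
    exact Set.union_subset (Set.range_subset_iff.mpr hφ) hs
  rw [← RingHom.map_closure] at hy hz
  obtain ⟨a, ha, rfl⟩ := hy
  obtain ⟨b, hb, rfl⟩ := hz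
  rcases eq_or_ne b 0 with rfl | hb0
  · rw [map_zero, div_zero, eq_comm, map_eq_zero_iff _ (IsFractionRing.injective C _)] at hyz
    exact ⟨1, one_mem W, one_ne_zero, by rw [hyz, mul_zero]; exact zero_mem W⟩
  · refine ⟨b, hle hb, hb0, ?_⟩
    rw [div_eq_iff ((map_ne_zero_iff _ (IsFractionRing.injective C _)).mpr hb0), ← map_mul] at hyz
    rw [mul_comm, ← IsFractionRing.injective C (FractionRing C) hyz]
    exact hle ha

variable {σ R A : Type*} [CommRing R] [IsDomain R] [CommRing A] {T : AddSubmonoid (σ →₀ ℕ)}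

theorem mem_supported_of_mem_genField (hT : IsFull T) {φ : A →+* MvPowerSeries σ R}
    {s : Set (MvPowerSeries σ R)} (hφ : ∀ a, φ a ∈ supported R T) (hs : s ⊆ supported R T)
    {θ : MvPowerSeries σ R} (h : algebraMap (MvPowerSeries σ R) _ θ ∈ genField φ s) :
    θ ∈ supported R T := by
  obtain ⟨b, hb, hb0, hbθ⟩ :=
    exists_mul_eq_of_mem_genField (W := (supported R T).toSubring) hφ hs h
  exact mem_supported_of_mul_mem hT hb hb0 hbθ

variable [Finite σ] {N : ℕ}

theorem algebraMap_mem_of_mem_supported (hN : N ≠ 0) (hT : IsFull T) (hNT : ∀ α, N • α ∈ T)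
    {u : σ → MvPowerSeries σ R} (hu : ∀ i, u i ∈ supported R T)
    (hu1 : ∀ i, constantCoeff (u i) = 1) {L : Subfield (FractionRing (MvPowerSeries σ R))}
    (hL : ∀ a, algebraMap (MvPowerSeries σ R) _ (twist hN u a) ∈ L)
    (hmon : ∀ α ∈ T, algebraMap (MvPowerSeries σ R) _ (monomial α 1) ∈ L)
    {g : MvPowerSeries σ R} (hg : g ∈ supported R T) :
    algebraMap (MvPowerSeries σ R) _ g ∈ L := by
  classical
  have := Fintype.ofFinite σ
  obtain ⟨h, h0, rfl⟩ := exists_eq_sum_twist hN hT hNT hu hu1 hg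
  rw [map_sum]
  refine sum_mem fun β _ => ?_
  rw [map_mul]
  by_cases hβ : boxExp β ∈ T
  · exact mul_mem (hmon _ hβ) (hL _)
  · rw [h0 β hβ, map_zero, map_zero, mul_zero]
    exact zero_mem L

theorem nonempty_normalization_equiv_supported {K : Type*} [Field K] (hN : N ≠ 0) (hT : IsFull T)
    (hNT : ∀ α, N • α ∈ T) {u : σ → MvPowerSeries σ K} (hu : ∀ i, u i ∈ supported K T)
    (hu1 : ∀ i, constantCoeff (u i) = 1) {f : (MvPowerSeries σ K)[X]} (hf : f.Monic)
    (hirr : Irreducible f) {ξ : MvPowerSeries σ K} (hξT : ξ ∈ supported K T)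
    (hξ : f.eval₂ (twist hN u).toRingHom ξ = 0)
    (hmon : ∀ α ∈ T, algebraMap (MvPowerSeries σ K) _ (monomial α 1) ∈
      genField (twist hN u).toRingHom {ξ}) :
    IsDomain (AdjoinRoot f) ∧ Nonempty (Normalization (AdjoinRoot f) ≃ₐ[K] supported K T) :=
  nonempty_normalization_equiv (twist hN u) (twist_injective hN hu1) (isIntegral_twist hN hu1) hf
    hirr hξ (supported K T) fun _ =>
      ⟨algebraMap_mem_of_mem_supported hN hT hNT hu hu1 (algebraMap_mem_genField _ _) hmon,
        mem_supported_of_mem_genField hT (twist_mem hN hNT hu) (Set.singleton_subset_iff.mpr hξT)⟩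

end SupportedField

section Descent

open MvPowerSeries

theorem pow_expChar_pow_eq_expand {σ R : Type*} [CommRing R] {p : ℕ} [ExpChar R p]
    (k : ℕ) (hp : p ^ k ≠ 0) (g : MvPowerSeries σ R) :
    g ^ p ^ k = MvPowerSeries.expand (p ^ k) hp (MvPowerSeries.map (iterateFrobenius R p k) g) := by
  rw [← MvPowerSeries.map_iterateFrobenius_expand p (expChar_pos R p).ne', MvPowerSeries.map_expand]

theorem separable_map_of_not_dvd {K A F : Type*} [Field K] [CommRing A] [Algebra K A] [IsDomain A]
    [IsIntegrallyClosed A] [Field F] [Algebra A F] [IsFractionRing A F] {f : A[X]} (hf : f.Monic)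
    (hirr : Irreducible f) (hd : ¬ ringChar K ∣ f.natDegree) :
    (f.map (algebraMap A F)).Separable := by
  rw [separable_iff_derivative_ne_zero
    ((hf.irreducible_iff_irreducible_map_fraction_map (K := F)).mp hirr)]
  intro hder
  have hd0 : f.natDegree - 1 + 1 = f.natDegree :=
    Nat.sub_add_cancel (Nat.pos_of_ne_zero fun h => hd (h ▸ dvd_zero _))
  have hlead : (f.natDegree : F) = 0 := by
    have h := congrArg (fun g => Polynomial.coeff g (f.natDegree - 1)) hder
    simp only [coeff_derivative, Polynomial.coeff_map, hd0, hf.coeff_natDegree, map_one, one_mul,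
      Polynomial.coeff_zero] at h
    rw [← hd0]
    exact_mod_cast h
  rw [← map_natCast (algebraMap A F), ← map_natCast (algebraMap K A),
    map_eq_zero_iff _ (IsFractionRing.injective A F),
    map_eq_zero_iff _ (algebraMap K A).injective] at hlead
  exact hd ((ringChar.spec K _).mp hlead)

theorem separable_map_map_of_injective {A B : Type*} [CommRing A] [CommRing B]
    [IsDomain B] {φ : A →+* B} (hφ : Function.Injective φ) {f : A[X]}
    (hsep : (f.map (algebraMap A (FractionRing A))).Separable) :
    ((f.map φ).map (algebraMap B (FractionRing B))).Separable := by
  let ψ : FractionRing A →+* FractionRing B := IsFractionRing.map hφ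
  have hψ : (algebraMap B (FractionRing B)).comp φ = ψ.comp (algebraMap A (FractionRing A)) :=
    (IsLocalization.map_comp _).symm
  rw [Polynomial.map_map, hψ, ← Polynomial.map_map]
  exact hsep.map

attribute [local instance] FractionRing.liftAlgebra in
theorem mem_range_of_separable_of_pow_mem {B C : Type*} [CommRing B] [IsDomain B]
    [IsIntegrallyClosed B] [CommRing C] [IsDomain C] {p : ℕ} [ExpChar B p] {χ : B →+* C}
    (hχ : Function.Injective χ) {g : B[X]} (hg : g.Monic)
    (hsep : (g.map (algebraMap B (FractionRing B))).Separable) {ξ : C} (hξ : g.eval₂ χ ξ = 0)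
    {k : ℕ} (hk : ξ ^ p ^ k ∈ χ.range) : ξ ∈ χ.range := by
  let _ : Algebra B C := χ.toAlgebra
  have : FaithfulSMul B C := (faithfulSMul_iff_algebraMap_injective B C).mpr hχ
  have : ExpChar (FractionRing B) p :=
    expChar_of_injective_ringHom (IsFractionRing.injective B (FractionRing B)) p
  set x := algebraMap C (FractionRing C) ξ with hx
  have hroot : aeval x g = 0 := by
    rw [hx, aeval_algebraMap_apply]
    exact (congrArg _ hξ).trans (map_zero _)
  have hxsep : IsSeparable (FractionRing B) x :=
    hsep.of_dvd (minpoly.dvd _ _ (by rwa [aeval_map_algebraMap]))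
  obtain ⟨e, he⟩ : ∃ e : FractionRing B, algebraMap _ _ e = x := by
    refine IntermediateField.mem_bot.mp ?_
    rw [← IntermediateField.adjoin_simple_le_iff,
      IntermediateField.adjoin_simple_eq_adjoin_pow_expChar_pow_of_isSeparable
        (FractionRing B) (FractionRing C) hxsep p k, IntermediateField.adjoin_simple_le_iff]
    obtain ⟨b, hb⟩ := hk
    refine IntermediateField.mem_bot.mpr ⟨algebraMap B _ b, ?_⟩
    rw [← IsScalarTower.algebraMap_apply, IsScalarTower.algebraMap_apply B C, hx, ← map_pow, ← hb]
    rfl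
  have heint : IsIntegral B e := by
    rw [← isIntegral_algebraMap_iff (algebraMap (FractionRing B) (FractionRing C)).injective, he]
    exact ⟨g, hg, hroot⟩
  obtain ⟨b, rfl⟩ := IsIntegrallyClosed.isIntegral_iff.mp heint
  refine ⟨b, IsFractionRing.injective C (FractionRing C) ?_⟩
  rw [← hx, ← he, ← IsScalarTower.algebraMap_apply, IsScalarTower.algebraMap_apply B C]
  rfl

variable {σ K : Type*} [Finite σ] [Field K]

theorem exists_root_of_separable {p : ℕ} [ExpChar K p] {m k : ℕ} (hm : m ≠ 0) (hq : p ^ k ≠ 0)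
    {f : (MvPowerSeries σ K)[X]} (hf : f.Monic)
    (hsep : (f.map (algebraMap _ (FractionRing (MvPowerSeries σ K)))).Separable)
    {ξ : MvPowerSeries σ K}
    (hξ : f.eval₂ (MvPowerSeries.expand (R := K) (p ^ k * m) (mul_ne_zero hq hm)).toRingHom ξ = 0) :
    ∃ ξ', f.eval₂ (MvPowerSeries.expand (R := K) m hm).toRingHom ξ' = 0 := by
  have : ExpChar (MvPowerSeries σ K) p :=
    expChar_of_injective_algebraMap (algebraMap K _).injective p
  have hξ' : (f.map (MvPowerSeries.expand (R := K) (σ := σ) m hm).toRingHom).eval₂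
      (MvPowerSeries.expand (R := K) (p ^ k) hq).toRingHom ξ = 0 := by
    rw [eval₂_map, ← hξ]
    congr 1
    ext1 a
    exact (MvPowerSeries.expand_mul (p ^ k) hq m hm a).symm
  obtain ⟨ξ', rfl⟩ := mem_range_of_separable_of_pow_mem (p := p) (k := k) (expand_injective hq)
    (hf.map _) (separable_map_map_of_injective (expand_injective hm) hsep) hξ'
    ⟨_, (pow_expChar_pow_eq_expand k hq ξ).symm⟩
  refine ⟨ξ', expand_injective hq ?_⟩
  rw [← eval_map, map_zero, ← hξ', eval₂_at_apply]
  rfl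

end Descent

/-! ### Tame extensions -/

section Exponents

open MvPowerSeries

variable {σ K : Type*} [Field K]

theorem algebraMap_X_ne_zero (i : σ) :
    algebraMap (MvPowerSeries σ K) (FractionRing (MvPowerSeries σ K)) (X i) ≠ 0 := by
  classical
  refine (map_ne_zero_iff _ (IsFractionRing.injective _ _)).mpr fun h => ?_
  have hcoeff := congrArg (MvPowerSeries.coeff (Finsupp.single i 1)) h
  rw [coeff_index_single_self_X, map_zero] at hcoeff
  exact one_ne_zero hcoeff

variable [Fintype σ]

/-- The Laurent monomial `x ^ z`. -/
noncomputable def laurent (K : Type*) [Field K] (z : σ → ℤ) : FractionRing (MvPowerSeries σ K) :=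
  ∏ i, algebraMap (MvPowerSeries σ K) _ (X i) ^ z i

theorem laurent_add (z w : σ → ℤ) : laurent K (z + w) = laurent K z * laurent K w := by
  rw [laurent, laurent, laurent, ← Finset.prod_mul_distrib]
  exact Finset.prod_congr rfl fun i _ => zpow_add₀ (algebraMap_X_ne_zero i) _ _

theorem laurent_neg (z : σ → ℤ) : laurent K (-z) = (laurent K z)⁻¹ := by
  rw [laurent, laurent, ← Finset.prod_inv_distrib]
  exact Finset.prod_congr rfl fun i _ => zpow_neg _ _

theorem laurent_castHom (α : σ →₀ ℕ) :
    laurent K (castHom σ α) = algebraMap (MvPowerSeries σ K) _ (monomial α 1) := by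
  rw [monomial_one_eq, Finsupp.prod_fintype _ _ fun _ => pow_zero _, map_prod, laurent]
  exact Finset.prod_congr rfl fun i _ => by rw [castHom_apply, zpow_natCast, map_pow]

theorem laurent_nsmul (N : ℕ) (z : σ → ℤ) :
    laurent K (N • z) = ∏ i, algebraMap (MvPowerSeries σ K) _ (X i ^ N) ^ z i :=
  Finset.prod_congr rfl fun i _ => by
    rw [map_pow, ← zpow_natCast, ← zpow_mul, Pi.smul_apply, nsmul_eq_mul]

/-- The exponents of the Laurent monomials in a subfield. -/
noncomputable def exponents (L : Subfield (FractionRing (MvPowerSeries σ K))) :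
    AddSubgroup (σ → ℤ) where
  carrier := {z | laurent K z ∈ L}
  zero_mem' := by simp [laurent]
  add_mem' {a b} ha hb := by
    rw [Set.mem_ofPred_eq, laurent_add]
    exact mul_mem ha hb
  neg_mem' {a} ha := by
    rw [Set.mem_ofPred_eq, laurent_neg]
    exact inv_mem ha

theorem mem_natPoints_exponents {L : Subfield (FractionRing (MvPowerSeries σ K))} {α : σ →₀ ℕ} :
    α ∈ natPoints (exponents L) ↔ algebraMap (MvPowerSeries σ K) _ (monomial α 1) ∈ L := by
  rw [← laurent_castHom]
  rfl

theorem nsmul_mem_exponents_genField {N : ℕ} (hN : N ≠ 0) (s : Set (MvPowerSeries σ K))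
    (z : σ → ℤ) :
    N • z ∈ exponents (genField (MvPowerSeries.expand (R := K) N hN).toRingHom s) := by
  change laurent K (N • z) ∈ genField _ s
  rw [laurent_nsmul]
  refine prod_mem fun i _ => zpow_mem ?_ _
  rw [← MvPowerSeries.expand_X N hN]
  exact algebraMap_mem_genField _ _ _

end Exponents

section Toric

open MvPowerSeries

variable {σ K : Type*} [Field K] {N : ℕ}

theorem isNoetherianRing_supported {R : Type*} [CommRing R] [IsNoetherianRing R] [Finite σ]
    {T : AddSubmonoid (σ →₀ ℕ)} (hN : N ≠ 0) (hT : IsFull T) (hNT : ∀ α, N • α ∈ T) :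
    IsNoetherianRing (supported R T) := by
  classical
  have := Fintype.ofFinite σ
  let φ : MvPowerSeries σ R →ₐ[R] supported R T :=
    (MvPowerSeries.expand N hN).codRestrict (supported R T) (expand_mem_supported hN hNT)
  let μ (β : σ → Fin N) : supported R T :=
    if h : boxExp β ∈ T then ⟨monomial (boxExp β) 1, monomial_mem_supported h 1⟩ else 0
  let _ : Algebra (MvPowerSeries σ R) (supported R T) := φ.toRingHom.toAlgebra
  have : Module.Finite (MvPowerSeries σ R) (supported R T) := by
    refine .of_surjective (Fintype.linearCombination _ μ) fun θ => ?_
    obtain ⟨h, h0, hh⟩ := exists_eq_sum_twist hN hT hNT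
      (u := fun _ => (1 : MvPowerSeries σ R)) (fun _ => one_mem _) (fun _ => map_one _) θ.2
    refine ⟨h, Subtype.ext ?_⟩
    rw [hh, Fintype.linearCombination_apply, AddSubmonoidClass.coe_finsetSum, twist_one]
    refine Finset.sum_congr rfl fun β _ => ?_
    by_cases hβ : boxExp β ∈ T
    · simp only [μ, dif_pos hβ]
      exact mul_comm _ _
    · rw [h0 β hβ, zero_smul, map_zero, mul_zero, ZeroMemClass.coe_zero]
  exact isNoetherian_of_tower (MvPowerSeries σ R) inferInstance

theorem exists_isLocalRing_of_algEquiv {T : AddSubmonoid (σ →₀ ℕ)} {D : Type*} [CommRing D]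
    [Algebra K D] (hT : IsFull T) (hfg : T.FG) (e : D ≃ₐ[K] supported K T) {n : ℕ}
    {S : AddSubmonoid (Fin n → ℚ)} (ε : S ≃+ T) :
    ∃ _ : IsLocalRing D,
      AnalyticallyIsomorphic K (IsLocalRing.maximalIdeal D) (specialIdeal K S) := by
  have : IsLocalRing (supported K T) := isLocalRing_supported hT
  have hloc : IsLocalRing D := e.symm.toRingEquiv.isLocalRing
  refine ⟨hloc, (AnalyticallyIsomorphic.of_algEquiv e).trans ?_⟩
  rw [maximalIdeal_supported hT]
  exact (analyticallyIsomorphic_supported hfg ε).symm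

theorem exists_isSimplicialPair {n : ℕ} (hN : N ≠ 0) {P : AddSubgroup (Fin n → ℤ)}
    (hP : ∀ z, N • z ∈ P) :
    ∃ (M : AddSubgroup (Fin n → ℚ)) (v : Fin n → Fin n → ℤ), IsSimplicialPair M v ∧
      Nonempty (semigroup M (cone v) ≃+ natPoints P) := by
  let v : Fin n → Fin n → ℤ := fun i j => if i = j then 1 else 0
  have hv : LinearIndependent ℝ fun i j => (v i j : ℝ) := by
    refine Fintype.linearIndependent_iff.mpr fun c hc i => ?_
    simpa [v] using congrFun hc i
  let w : Fin n → Fin n → ℚ := fun i j => 1 * (v i j : ℚ)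
  have hw : LinearIndependent ℚ w := by
    simpa only [w, one_mul] using linearIndependent_cast_rat hv
  have hcomap : (P.map (latMap N w)).comap (latMap N w) = P :=
    AddSubgroup.comap_map_eq_self_of_injective (latMap_injective hN hw) P
  have hfg : P.FG :=
    P.toIntSubmodule.fg_iff_addSubgroup_fg.mp (IsNoetherian.noetherian P.toIntSubmodule)
  refine ⟨P.map (latMap N w), v, ⟨?_, fun a => ⟨N • a, hP a, ?_⟩, hv⟩, ?_⟩
  · obtain ⟨G, hG⟩ := hfg
    classical
    exact ⟨G.image (latMap N w), by rw [Finset.coe_image, ← AddMonoidHom.map_closure, hG]⟩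
  · rw [latMap_nsmul hN]
    ext j
    simp [w, v]
  · have hle : P.map (latMap N w) ≤ (latMap N w).range := by
      rintro _ ⟨z, -, rfl⟩
      exact ⟨z, rfl⟩
    have hequiv : Nonempty (semigroup (P.map (latMap N w)) (cone v) ≃+
        natPoints ((P.map (latMap N w)).comap (latMap N w))) :=
      nonempty_semigroup_equiv hv hN (fun _ => one_pos) hle
    rwa [hcomap] at hequiv

theorem exists_eq_pow_mul_and_natCast_ne_zero (R : Type*) [NonAssocRing R] (p : ℕ)
    [hp : ExpChar R p] {m : ℕ} (hm : m ≠ 0) :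
    ∃ k N : ℕ, (N : R) ≠ 0 ∧ m = p ^ k * N := by
  cases hp with
  | zero => exact ⟨0, m, by exact_mod_cast hm, by rw [pow_zero, one_mul]⟩
  | prime hpr =>
    obtain ⟨k, N, hN, hm⟩ := Nat.exists_eq_pow_mul_and_not_dvd hm p hpr.ne_one
    exact ⟨k, N, by rwa [Ne, CharP.cast_eq_zero_iff R p], hm⟩

theorem exists_isPrimitiveRoot (A : Type*) [CommRing A] [Nontrivial A] [Algebra K A]
    [IsAlgClosed K] (hN : (N : K) ≠ 0) : ∃ ζ : A, IsPrimitiveRoot ζ N := by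
  have : NeZero (N : K) := ⟨hN⟩
  obtain ⟨ζ, hζ⟩ := HasEnoughRootsOfUnity.exists_primitiveRoot K N
  exact ⟨_, hζ.map_of_injective (algebraMap K A).injective⟩

variable [IsAlgClosed K]

theorem mem_supported_exponents [Fintype σ] (hN : (N : K) ≠ 0) (hN0 : N ≠ 0)
    {L : Subfield (FractionRing (MvPowerSeries σ K))}
    (hL : ∀ a, algebraMap (MvPowerSeries σ K) _ (MvPowerSeries.expand N hN0 a) ∈ L)
    (hNL : ∀ z, N • z ∈ exponents L) {θ : MvPowerSeries σ K}
    (hθ : algebraMap (MvPowerSeries σ K) _ θ ∈ L) :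
    θ ∈ supported K (natPoints (exponents L)) := by
  classical
  have : NeZero N := ⟨hN0⟩
  obtain ⟨ζ, hζ⟩ := exists_isPrimitiveRoot (MvPowerSeries σ K) hN
  have hbasis := isRadicalBasis_expand (R := K) (σ := σ) hN0
  obtain ⟨c, rfl⟩ := hbasis.bijective.surjective θ
  refine sum_mem fun β _ => ?_
  rcases eq_or_ne (c β) 0 with h0 | h0
  · simp only [h0, map_zero, zero_mul, zero_mem]
  · exact mul_mem (expand_mem_supported hN0 (nsmul_mem_natPoints hNL) _) (monomial_mem_supported
      (mem_natPoints_exponents.mpr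
        (hbasis.mem_of_sum_mem (expand_injective hN0) hζ L hL c hθ h0)) 1)

variable {n : ℕ} {f : (MvPowerSeries (Fin n) K)[X]}

omit [IsAlgClosed K] in
theorem IsPuiseux.exists_root (hf : IsPuiseux f) (hirr : Irreducible f)
    (hd : ¬ ringChar K ∣ f.natDegree) :
    ∃ (N : ℕ) (hN : N ≠ 0) (θ : MvPowerSeries (Fin n) K),
      (N : K) ≠ 0 ∧ f.eval₂ (MvPowerSeries.expand (R := K) N hN).toRingHom θ = 0 := by
  obtain ⟨hmon, m, hm, d, ξ, hprod⟩ := hf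
  obtain ⟨p, hp⟩ := ExpChar.exists K
  obtain ⟨k, N, hNK, rfl⟩ := exists_eq_pow_mul_and_natCast_ne_zero K p hm
  have hN : N ≠ 0 := right_ne_zero_of_mul hm
  have hd0 : d ≠ 0 := by
    rintro rfl
    have hdeg := congrArg natDegree hprod
    rw [hmon.natDegree_map, Fin.prod_univ_zero, natDegree_one] at hdeg
    exact hd (hdeg ▸ dvd_zero _)
  obtain ⟨θ, hθ⟩ := exists_root_of_separable (ξ := ξ ⟨0, Nat.pos_of_ne_zero hd0⟩) hN
    (left_ne_zero_of_mul hm) hmon (separable_map_of_not_dvd (K := K) hmon hirr hd) (by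
      rw [← eval_map, hprod, eval_prod]
      exact Finset.prod_eq_zero (Finset.mem_univ _) (by rw [eval_sub, eval_X, eval_C, sub_self]))
  exact ⟨N, hN, θ, hNK, hθ⟩

theorem exists_normalization_equiv_supported (hf : IsPuiseux f) (hirr : Irreducible f)
    (hd : ¬ ringChar K ∣ f.natDegree) :
    ∃ (N : ℕ) (_ : N ≠ 0) (P : AddSubgroup (Fin n → ℤ)) (_ : ∀ z, N • z ∈ P),
      IsDomain (AdjoinRoot f) ∧
        Nonempty (Normalization (AdjoinRoot f) ≃ₐ[K] supported K (natPoints P)) := by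
  obtain ⟨N, hN, θ, hNK, hθ⟩ := hf.exists_root hirr hd
  set L := genField (MvPowerSeries.expand (R := K) (σ := Fin n) N hN).toRingHom {θ}
  have hNL : ∀ z, N • z ∈ exponents L := nsmul_mem_exponents_genField hN _
  have hθL : θ ∈ supported K (natPoints (exponents L)) :=
    mem_supported_exponents hNK hN (algebraMap_mem_genField _ _) hNL
      (mem_genField_of_mem _ (Set.mem_singleton θ))
  refine ⟨N, hN, exponents L, hNL, nonempty_normalization_equiv_supported hN (isFull_natPoints _)
    (nsmul_mem_natPoints hNL) (u := fun _ => 1) (fun _ => one_mem _) (fun _ => map_one _) hf.1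
    hirr hθL ?_ ?_⟩ <;> rw [twist_one]
  · exact hθ
  · exact fun α hα => mem_natPoints_exponents.mp hα

theorem isRegularLocalRing_or_isHirzebruchJung (hf : IsPuiseux f) (hirr : Irreducible f)
    (hd : ¬ ringChar K ∣ f.natDegree) :
    ∃ _ : IsLocalRing (Normalization (AdjoinRoot f)),
      IsRegularLocalRing (Normalization (AdjoinRoot f)) ∨
        IsHirzebruchJung K n (Normalization (AdjoinRoot f)) := by
  obtain ⟨N, hN, P, hP, hdom, ⟨e⟩⟩ := exists_normalization_equiv_supported hf hirr hd
  obtain ⟨M, v, hpair, ⟨ε⟩⟩ := exists_isSimplicialPair hN hP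
  have hT := isFull_natPoints P
  have hNT := nsmul_mem_natPoints hP
  obtain ⟨hloc, hiso⟩ := exists_isLocalRing_of_algEquiv hT (fg_of_isFull hN hT hNT) e ε
  have hnoeth : IsNoetherianRing (Normalization (AdjoinRoot f)) :=
    have := isNoetherianRing_supported (R := K) hN hT hNT
    isNoetherianRing_of_ringEquiv _ e.symm.toRingEquiv
  exact ⟨hloc, or_iff_not_imp_left.mpr fun hsing => ⟨M, v, hpair, hnoeth, inferInstance,
    integralClosure.isIntegrallyClosedOfFiniteExtension (FractionRing (AdjoinRoot f)), hsing,
    hiso⟩⟩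

end Toric

section Tame

open MvPowerSeries

theorem exists_irreducible_of_isIntegral {A C : Type*} [CommRing A] [IsDomain A] [CommRing C]
    [IsDomain C] {φ : A →+* C} (hφ : φ.IsIntegral) (ξ : C) :
    ∃ f : A[X], f.Monic ∧ Irreducible f ∧ f.eval₂ φ ξ = 0 := by
  let _ : Algebra A C := φ.toAlgebra
  have h : IsIntegral A ξ := hφ ξ
  exact ⟨minpoly A ξ, minpoly.monic h, minpoly.irreducible h, minpoly.aeval A ξ⟩

variable {n : ℕ} {K : Type*} [Field K] [IsAlgClosed K]

theorem exists_isPuiseux_of_natCast_ne_zero {N : ℕ} (hN : (N : K) ≠ 0)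
    {T : AddSubmonoid (Fin n →₀ ℕ)} (hT : IsFull T) (hNT : ∀ α, N • α ∈ T) :
    ∃ f : (MvPowerSeries (Fin n) K)[X], IsPuiseux f ∧ Irreducible f ∧ f.natDegree ∣ N ^ n ∧
      Nonempty (Normalization (AdjoinRoot f) ≃ₐ[K] supported K T) := by
  have hN0 : N ≠ 0 := by
    rintro rfl
    exact hN Nat.cast_zero
  have : NeZero N := ⟨hN0⟩
  obtain ⟨ζ, hζ⟩ := exists_isPrimitiveRoot (MvPowerSeries (Fin n) K) hN
  have hbasis := isRadicalBasis_expand (R := K) (σ := Fin n) hN0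
  have hinj := expand_injective (R := K) (σ := Fin n) hN0
  obtain ⟨ξ, hξ⟩ := hbasis.exists_primitive hinj hζ
    (genField (MvPowerSeries.expand (R := K) N hN0).toRingHom ((monomial · 1) '' T))
    (algebraMap_mem_genField _ _)
  have hξT : ξ ∈ supported K T := by
    refine mem_supported_of_mem_genField hT (expand_mem_supported hN0 hNT) ?_
      (hξ ▸ mem_genField_of_mem _ (Set.mem_singleton ξ))
    rintro _ ⟨α, hα, rfl⟩
    exact monomial_mem_supported hα 1
  obtain ⟨f, hf, hirr, hfξ⟩ := exists_irreducible_of_isIntegral hbasis.isIntegral ξ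
  refine ⟨f, isPuiseux_of_splits hf hN0 (hbasis.splits hinj hζ hf hirr hfξ), hirr, ?_, ?_⟩
  · simpa using hbasis.natDegree_dvd hinj hf hirr hfξ
  · refine (nonempty_normalization_equiv_supported hN0 hT hNT (u := fun _ => 1)
      (fun _ => one_mem _) (fun _ => map_one _) hf hirr hξT ?_ ?_).2 <;> rw [twist_one]
    · exact hfξ
    · intro α hα
      rw [hξ]
      exact mem_genField_of_mem _ ⟨α, hα, rfl⟩

end Tame

/-! ### Primitive elements and substitutions -/

section PrimitiveElement

variable {K F E : Type*} [Field K] [Field F] [Algebra K F] [Field E] [Algebra F E]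
  [Algebra K E] [IsScalarTower K F E]

theorem coeff_mem_of_infinite_eval_mem (G : IntermediateField F E) {s : Set K} (hs : s.Infinite)
    {g : E[X]} (hg : ∀ c ∈ s, g.eval (algebraMap K E c) ∈ G) (k : ℕ) : g.coeff k ∈ G := by
  classical
  obtain ⟨t, hts, ht⟩ := hs.exists_subset_card_eq (g.natDegree + 1)
  let r (c : K) : G := if h : g.eval (algebraMap K E c) ∈ G then ⟨_, h⟩ else 0
  have hr : ∀ c ∈ t, (r c : E) = g.eval (algebraMap K E c) := fun c hc => by
    simp only [r, dif_pos (hg c (hts hc))]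
  have hinj : Set.InjOn (algebraMap K G) (t : Set K) := (algebraMap K G).injective.injOn
  have hinterp : g = (Lagrange.interpolate t (algebraMap K G) r).map (algebraMap G E) := by
    refine Polynomial.eq_of_degrees_lt_of_eval_index_eq (v := algebraMap K E) t
      (algebraMap K E).injective.injOn ?_ ?_ fun c hc => ?_
    · rw [ht]
      exact degree_le_natDegree.trans_lt (by exact_mod_cast Nat.lt_succ_self _)
    · rw [degree_map]
      exact Lagrange.degree_interpolate_lt r hinj
    · rw [← hr c hc, show algebraMap K E c = algebraMap G E (algebraMap K G c) from rfl,
        eval_map_algebraMap, aeval_algebraMap_apply, coe_aeval_eq_eval,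
        Lagrange.eval_interpolate_at_node r hinj hc]
      rfl
  rw [hinterp, Polynomial.coeff_map]
  exact (Polynomial.coeff (Lagrange.interpolate t (algebraMap K G) r) k).2

theorem coeff_one_one_add_C_mul_X_pow {R : Type*} [CommSemiring R] (a : R) (m : ℕ) :
    ((1 + C a * X) ^ m : R[X]).coeff 1 = m * a := by
  have hcomp : ((1 + C a * X) ^ m : R[X]) = ((1 + X) ^ m).comp (C a * X) := by simp
  rw [hcomp, comp_C_mul_X_coeff, coeff_one_add_X_pow, Nat.choose_one_right, pow_one]

variable [Infinite K]

-- Infinitely many of the finitely many fields `F(x⁻¹ (1 + c x η) ^ m)` coincide; interpolation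
-- then puts the coefficient `m η` of `c` into the common field.
theorem exists_mem_adjoin_of_finite [Finite (IntermediateField F E)] {m : ℕ} (hm : (m : K) ≠ 0)
    (η : E) {x : E} (hx : x ≠ 0) :
    ∃ c : K, η ∈ IntermediateField.adjoin F {x⁻¹ * (1 + algebraMap K E c * (x * η)) ^ m} := by
  obtain ⟨G, hG⟩ := Finite.exists_infinite_fiber fun c : K =>
    IntermediateField.adjoin F {x⁻¹ * (1 + algebraMap K E c * (x * η)) ^ m}
  rw [Set.infinite_coe_iff] at hG
  let g : E[X] := C x⁻¹ * (1 + C (x * η) * X) ^ m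
  have hg : ∀ c ∈ (fun c : K => IntermediateField.adjoin F
      {x⁻¹ * (1 + algebraMap K E c * (x * η)) ^ m}) ⁻¹' {G}, g.eval (algebraMap K E c) ∈ G := by
    rintro c rfl
    simpa [g, mul_comm] using IntermediateField.mem_adjoin_simple_self F _
  have hcoeff : g.coeff 1 = m * η := by
    rw [coeff_C_mul, coeff_one_one_add_C_mul_X_pow, mul_left_comm, inv_mul_cancel_left₀ hx]
  have hmE : (m : E) ≠ 0 := by
    rw [← map_natCast (algebraMap K E)]
    exact (_root_.map_ne_zero _).mpr hm
  have hη : η ∈ G := by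
    rw [← inv_mul_cancel_left₀ hmE η, ← hcoeff]
    exact mul_mem (inv_mem (natCast_mem G m)) (coeff_mem_of_infinite_eval_mem G hG hg 1)
  obtain ⟨c, rfl⟩ := hG.nonempty
  exact ⟨c, hη⟩

theorem exists_mem_adjoin_of_isAlgebraic {m : ℕ} (hm : (m : K) ≠ 0) {η : E}
    (hη : IsAlgebraic F η) {x : E} (hx : x ≠ 0) (hxη : x ∈ IntermediateField.adjoin F {η}) :
    ∃ c : K, η ∈ IntermediateField.adjoin F {x⁻¹ * (1 + algebraMap K E c * (x * η)) ^ m} := by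
  have : FiniteDimensional F (IntermediateField.adjoin F {η}) :=
    IntermediateField.adjoin.finiteDimensional hη.isIntegral
  have : Finite (IntermediateField F (IntermediateField.adjoin F {η})) :=
    Field.finite_intermediateField_of_exists_primitive_element F _
      ⟨_, IntermediateField.adjoin_eq_top_of_algebra F _
        (IntermediateField.adjoin.powerBasis hη.isIntegral).adjoin_gen_eq_top⟩
  obtain ⟨c, hc⟩ := exists_mem_adjoin_of_finite (K := K) (F := F) hm
    (IntermediateField.AdjoinSimple.gen F η) (x := ⟨x, hxη⟩)
    fun h => hx (congrArg Subtype.val h)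
  have hmap : η ∈ (IntermediateField.adjoin F _).map (IntermediateField.adjoin F {η}).val :=
    ⟨_, hc, rfl⟩
  rw [IntermediateField.adjoin_map, Set.image_singleton] at hmap
  exact ⟨c, hmap⟩

end PrimitiveElement

section Inseparable

theorem dvd_expand_of_eval₂_pow_eq_zero {A C : Type*} [CommRing A] [IsDomain A]
    [IsIntegrallyClosed A] [CommRing C] [IsDomain C] {φ : A →+* C} (hφ : Function.Injective φ)
    {f G : A[X]} (hf : f.Monic) (hirr : Irreducible f) {ξ : C} (hξ : f.eval₂ φ ξ = 0) {q : ℕ}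
    (hG : G.eval₂ φ (ξ ^ q) = 0) : f ∣ Polynomial.expand A q G := by
  let _ : Algebra A C := φ.toAlgebra
  have : FaithfulSMul A C := (faithfulSMul_iff_algebraMap_injective A C).mpr hφ
  rw [eq_minpoly_of_irreducible hf hirr (ξ := ξ) hξ]
  refine minpoly.isIntegrallyClosed_dvd ⟨f, hf, hξ⟩ ?_
  rw [expand_aeval]
  exact hG

theorem splits_map_expand {B C : Type*} [CommRing B] [CommRing C] {p : ℕ} [ExpChar C p]
    {φ : B →+* C} {k : ℕ} (hφ : ∀ b, ∃ c, c ^ p ^ k = φ b) {G : B[X]} (hG : G.Splits) :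
    ((Polynomial.expand B (p ^ k) G).map φ).Splits := by
  induction hG using Submonoid.closure_induction with
  | mem g hg =>
    rcases hg with ⟨b, rfl⟩ | ⟨b, rfl⟩
    · rw [Polynomial.expand_C, Polynomial.map_C]
      exact .C _
    · obtain ⟨c, hc⟩ := hφ b
      have hpow : (Polynomial.expand B (p ^ k) (Polynomial.X + Polynomial.C b)).map φ =
          (Polynomial.X + Polynomial.C c) ^ p ^ k := by
        rw [add_pow_expChar_pow, ← Polynomial.C_pow, hc]
        simp
      rw [hpow]
      exact (Splits.X_add_C c).pow _
  | one => simpa only [map_one, Polynomial.map_one] using Splits.one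
  | mul g h _ _ hg hh =>
    rw [map_mul, Polynomial.map_mul]
    exact hg.mul hh

theorem exists_pow_eq_expand {σ R : Type*} [CommRing R] {p : ℕ} [ExpChar R p]
    [PerfectRing R p] (k : ℕ) (hp : p ^ k ≠ 0) (h : MvPowerSeries σ R) :
    ∃ g, g ^ p ^ k = MvPowerSeries.expand (p ^ k) hp h := by
  refine ⟨MvPowerSeries.map (iterateFrobeniusEquiv R p k).symm.toRingHom h, ?_⟩
  rw [pow_expChar_pow_eq_expand k hp]
  congr 1
  ext α
  simp only [MvPowerSeries.coeff_map]
  exact (iterateFrobeniusEquiv R p k).apply_symm_apply _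

theorem isPuiseux_of_pow_mem_range {n : ℕ} {K : Type*} [Field K] [IsAlgClosed K] {p : ℕ}
    [ExpChar K p] {k m : ℕ} (hp : p ^ k ≠ 0) (hm : (m : K) ≠ 0) (hm0 : m ≠ 0) {C : Type*}
    [CommRing C] [IsDomain C] {ψ : MvPowerSeries (Fin n) K →+* C} (hψ : Function.Injective ψ)
    {f : (MvPowerSeries (Fin n) K)[X]} (hf : f.Monic) (hirr : Irreducible f) {ξ : C}
    (hξ : f.eval₂ (ψ.comp (MvPowerSeries.expand m hm0).toRingHom) ξ = 0)
    (hpow : ξ ^ p ^ k ∈ ψ.range) : IsPuiseux f := by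
  have : NeZero m := ⟨hm0⟩
  obtain ⟨h, hh⟩ := hpow
  obtain ⟨ζ, hζ⟩ := exists_isPrimitiveRoot (MvPowerSeries (Fin n) K) hm
  have hbasis := isRadicalBasis_expand (R := K) (σ := Fin n) hm0
  have hinj := expand_injective (R := K) (σ := Fin n) hm0
  obtain ⟨G, hG, hGirr, hGh⟩ := exists_irreducible_of_isIntegral hbasis.isIntegral h
  have hdvd : f ∣ Polynomial.expand _ (p ^ k) G :=
    dvd_expand_of_eval₂_pow_eq_zero
      (φ := ψ.comp (MvPowerSeries.expand m hm0).toRingHom) (hψ.comp hinj) hf hirr hξ <| by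
        rw [← hh, ← hom_eval₂, hGh, map_zero]
  have hcomp : (MvPowerSeries.expand (R := K) (σ := Fin n) (p ^ k * m)
      (mul_ne_zero hp hm0)).toRingHom = (MvPowerSeries.expand (p ^ k) hp).toRingHom.comp
        (MvPowerSeries.expand m hm0).toRingHom :=
    RingHom.ext fun a => MvPowerSeries.expand_mul _ hp _ hm0 a
  have : ExpChar (MvPowerSeries (Fin n) K) p :=
    expChar_of_injective_algebraMap (algebraMap K _).injective p
  refine isPuiseux_of_splits hf (mul_ne_zero hp hm0)
    (Splits.of_dvd ?_ (hG.expand (Nat.pos_of_ne_zero hp) |>.map _).ne_zero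
      (Polynomial.map_dvd _ hdvd))
  rw [hcomp, ← Polynomial.map_map, Polynomial.map_expand]
  exact splits_map_expand (exists_pow_eq_expand k hp) (hbasis.splits hinj hζ hG hGirr hGh)

end Inseparable

section Triangular

open MvPowerSeries

variable {σ : Type*} [Finite σ]

theorem twist_comp_expand {R : Type*} [CommRing R] {q m : ℕ} (hq : q ≠ 0) (hm : m ≠ 0)
    (w : σ → MvPowerSeries σ R) :
    twist (mul_ne_zero hq hm) (fun i => w i ^ m) =
      (twist hq w).comp (MvPowerSeries.expand m hm) := by
  have hcomp := substAlgHom_comp_substAlgHom (R := R) (S := R)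
    (hasSubst_X_pow_mul (R := R) (σ := σ) hm fun _ => 1) (hasSubst_X_pow_mul hq w)
  rw [← twist_one]
  refine AlgHom.ext fun a => Eq.trans ?_ (DFunLike.congr_fun hcomp a).symm
  rw [twist]
  congr 2
  ext1 i
  rw [mul_one, map_pow, substAlgHom_X, mul_pow, ← pow_mul]

variable {K : Type*} [Field K]

theorem constantCoeff_twist {N : ℕ} (hN : N ≠ 0) (u : σ → MvPowerSeries σ K)
    (g : MvPowerSeries σ K) : constantCoeff (twist hN u g) = constantCoeff g := by
  rw [← coeff_zero_eq_constantCoeff_apply, coeff_twist, finsum_eq_single _ 0 fun γ hγ => ?_]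
  · simp [powProd]
  · refine mul_eq_zero_of_right _ (of_not_not fun h => hγ ?_)
    have hle := le_of_coeff_monomial_mul_ne_zero h
    exact (smul_eq_zero.mp (le_zero_iff.mp hle)).resolve_left hN

theorem twist_inv {N : ℕ} (hN : N ≠ 0) (u : σ → MvPowerSeries σ K) (g : MvPowerSeries σ K) :
    twist hN u g⁻¹ = (twist hN u g)⁻¹ := by
  by_cases h : constantCoeff g = 0
  · rw [MvPowerSeries.inv_eq_zero.mpr h, map_zero, eq_comm, MvPowerSeries.inv_eq_zero,
      constantCoeff_twist, h]
  · rw [MvPowerSeries.eq_inv_iff_mul_eq_one (by rwa [constantCoeff_twist]), ← map_mul,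
      MvPowerSeries.inv_mul_cancel g h, map_one]

/-- The elements whose `p ^ e`-th power lies in a given subalgebra. -/
def powPreimage {R C : Type*} [CommRing R] [CommRing C] [Algebra R C] (p : ℕ) [ExpChar C p]
    (e : ℕ) (S : Subalgebra R C) : Subalgebra R C where
  carrier := {h | h ^ p ^ e ∈ S}
  mul_mem' {a b} ha hb := by
    rw [Set.mem_ofPred_eq, mul_pow]
    exact mul_mem ha hb
  add_mem' {a b} ha hb := by
    rw [Set.mem_ofPred_eq, add_pow_expChar_pow]
    exact add_mem ha hb
  algebraMap_mem' r := by
    rw [Set.mem_ofPred_eq, ← map_pow]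
    exact S.algebraMap_mem _

theorem powPreimage_mono {R C : Type*} [CommRing R] [CommRing C] [Algebra R C] (p : ℕ)
    [ExpChar C p] (S : Subalgebra R C) : Monotone fun e => powPreimage p e S := by
  refine monotone_nat_of_le_succ fun e x (hx : x ^ p ^ e ∈ S) => ?_
  change x ^ p ^ (e + 1) ∈ S
  rw [pow_succ, pow_mul]
  exact pow_mem hx _

variable {p : ℕ} [ExpChar (MvPowerSeries σ K) p] {k : ℕ} {w : σ → MvPowerSeries σ K}

theorem X_mem_powPreimage_range_twist (hq : p ^ k ≠ 0) {i : σ}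
    (hw1 : constantCoeff (w i) = 1) {e : ℕ} (hw : w i ∈ powPreimage p e (twist hq w).range) :
    X i ∈ powPreimage p (k + e) (twist hq w).range := by
  obtain ⟨g, hg⟩ := hw
  have hcancel : w i ^ p ^ e * (w i ^ p ^ e)⁻¹ = 1 :=
    MvPowerSeries.mul_inv_cancel _ (by rw [map_pow, hw1, one_pow]; exact one_ne_zero)
  refine ⟨X i ^ p ^ e * g⁻¹, ?_⟩
  change twist hq w _ = _
  change twist hq w g = _ at hg
  rw [map_mul, map_pow, twist_X, twist_inv, hg, mul_pow, mul_assoc, hcancel, mul_one, ← pow_mul,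
    ← pow_add]

theorem exists_X_mem_powPreimage [Preorder σ] (hq : p ^ k ≠ 0)
    (hw : ∀ j, w j ∈ Algebra.adjoin K (X '' Set.Iio j)) (hw1 : ∀ j, constantCoeff (w j) = 1) :
    ∃ e : ℕ, ∀ i, X i ∈ powPreimage p e (twist hq w).range := by
  have : Fintype σ := Fintype.ofFinite σ
  have hmono := powPreimage_mono p (twist hq w).range
  have hbound (s : Set σ) (h : ∀ i ∈ s, ∃ e, X i ∈ powPreimage p e (twist hq w).range) :
      ∃ e, ∀ i ∈ s, X i ∈ powPreimage p e (twist hq w).range := by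
    choose! e he using h
    exact ⟨Finset.univ.sup e, fun i hi => hmono (Finset.le_sup (Finset.mem_univ i)) (he i hi)⟩
  suffices ∀ i, ∃ e, X i ∈ powPreimage p e (twist hq w).range by
    obtain ⟨e, he⟩ := hbound Set.univ fun i _ => this i
    exact ⟨e, fun i => he i (Set.mem_univ i)⟩
  intro i
  induction i using WellFoundedLT.induction with
  | ind i ih =>
    obtain ⟨e, he⟩ := hbound (Set.Iio i) ih
    exact ⟨k + e, X_mem_powPreimage_range_twist hq (hw1 i)
      (Algebra.adjoin_le (Set.image_subset_iff.mpr he) (hw i))⟩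

end Triangular

/-! ### Wild extensions and the converse -/

section InitialPart

variable {n : ℕ} {P : AddSubgroup (Fin n → ℤ)} {N : ℕ}

/-- The elements of `P` supported in the first `i` coordinates. -/
def initialPart (P : AddSubgroup (Fin n → ℤ)) (i : ℕ) : AddSubgroup (Fin n → ℤ) where
  carrier := {z | z ∈ P ∧ ∀ j : Fin n, i ≤ j → z j = 0}
  zero_mem' := ⟨zero_mem _, fun _ _ => rfl⟩
  add_mem' {a b} ha hb := ⟨add_mem ha.1 hb.1, fun j hj => by simp [ha.2 j hj, hb.2 j hj]⟩
  neg_mem' {a} ha := ⟨neg_mem ha.1, fun j hj => by simp [ha.2 j hj]⟩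

theorem mem_initialPart_of_apply_eq_zero {i : Fin n} {z : Fin n → ℤ}
    (hz : z ∈ initialPart P (i + 1)) (hi : z i = 0) : z ∈ initialPart P i := by
  refine ⟨hz.1, fun j hj => ?_⟩
  rcases eq_or_ne j i with rfl | hji
  · exact hi
  · exact hz.2 j (lt_of_le_of_ne hj fun h => hji (Fin.ext h.symm))

theorem nsmul_single_mem_initialPart (hP : ∀ z, N • z ∈ P) (i : Fin n) :
    castHom (Fin n) (Finsupp.single i N) ∈ initialPart P (i + 1) := by
  have hcast : castHom (Fin n) (Finsupp.single i N) = N • Pi.single i 1 := by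
    ext j
    rcases eq_or_ne j i with rfl | hji
    · simp
    · simp [hji]
  refine ⟨hcast ▸ hP _, fun j hj => ?_⟩
  rw [castHom_apply, Finsupp.single_eq_of_ne, Nat.cast_zero]
  rintro rfl
  omega

theorem exists_castHom_mem_initialPart (hN : N ≠ 0) (hP : ∀ z, N • z ∈ P) {i : ℕ}
    {z : Fin n → ℤ} (hz : z ∈ initialPart P i) :
    ∃ a, castHom (Fin n) a ∈ initialPart P i ∧ ∀ j, 0 ≤ z j → (a j : ℤ) = z j := by
  have hnonneg : 0 ≤ z + N • z⁻ := by
    refine (posPart_nonneg z).trans ?_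
    rw [← sub_add_cancel z⁺ z⁻, posPart_sub_negPart]
    exact add_le_add_right (le_self_nsmul (negPart_nonneg z) hN) _
  obtain ⟨a, ha⟩ := exists_castHom_eq hnonneg
  have hneg (j : Fin n) (hj : 0 ≤ z j) : z⁻ j = 0 := by
    rw [Pi.negPart_apply, negPart_eq_zero.mpr hj]
  refine ⟨a, ha ▸ add_mem hz ⟨hP _, fun j hj => ?_⟩, fun j hj => ?_⟩
  · rw [Pi.smul_apply, hneg j (hz.2 j hj).ge, smul_zero]
  · rw [← castHom_apply, ha, Pi.add_apply, Pi.smul_apply, hneg j hj, smul_zero, add_zero]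

theorem exists_forall_mem_iff_natCast_dvd (H : AddSubgroup ℤ) :
    ∃ d : ℕ, ∀ x, x ∈ H ↔ (d : ℤ) ∣ x := by
  obtain ⟨r, rfl⟩ := Int.subgroup_cyclic H
  refine ⟨r.natAbs, fun x => ?_⟩
  rw [← AddSubgroup.zmultiples_eq_closure, Int.mem_zmultiples_iff, Int.natAbs_dvd]

theorem exists_minimal_vector (hN : N ≠ 0) (hP : ∀ z, N • z ∈ P) (i : Fin n) :
    ∃ (a g : Fin n →₀ ℕ) (k : ℕ), castHom (Fin n) a ∈ initialPart P (i + 1) ∧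
      castHom (Fin n) g ∈ initialPart P i ∧ k • a = g + Finsupp.single i N ∧
      ∀ z ∈ initialPart P (i + 1), ∃ t : ℤ, z - t • castHom (Fin n) a ∈ initialPart P i := by
  obtain ⟨d, hd⟩ := exists_forall_mem_iff_natCast_dvd
    ((initialPart P (i + 1)).map (Pi.evalAddMonoidHom (fun _ => ℤ) i))
  have hsingle := nsmul_single_mem_initialPart hP i
  obtain ⟨k, hk⟩ : d ∣ N := by
    refine Int.natCast_dvd_natCast.mp ((hd N).mp ⟨_, hsingle, ?_⟩)
    simp
  obtain ⟨z, hz, hzi⟩ := (hd d).mpr dvd_rfl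
  replace hzi : z i = d := hzi
  obtain ⟨a, ha, hai⟩ := exists_castHom_mem_initialPart hN hP hz
  replace hai : a i = d := by exact_mod_cast (hai i (hzi ▸ Int.natCast_nonneg d)).trans hzi
  have hka : k • a = (k • a).erase i + Finsupp.single i N := by
    conv_lhs => rw [← Finsupp.erase_add_single i (k • a)]
    rw [Finsupp.smul_apply, hai, smul_eq_mul, hk, mul_comm]
  refine ⟨a, (k • a).erase i, k, ha, mem_initialPart_of_apply_eq_zero ?_ ?_, hka, fun y hy => ?_⟩
  · rw [← add_sub_cancel_right (castHom (Fin n) _) (castHom (Fin n) (Finsupp.single i N)),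
      ← map_add, ← hka, map_nsmul]
    exact sub_mem (nsmul_mem ha k) hsingle
  · rw [castHom_apply, Finsupp.erase_same, Nat.cast_zero]
  · obtain ⟨t, ht⟩ := (hd (y i)).mp ⟨y, hy, rfl⟩
    refine ⟨t, mem_initialPart_of_apply_eq_zero (sub_mem hy (zsmul_mem ha t)) ?_⟩
    rw [Pi.sub_apply, Pi.smul_apply, castHom_apply, hai, ht, smul_eq_mul, mul_comm, sub_self]

end InitialPart

section Wild

open MvPowerSeries

variable {n : ℕ} {K : Type*} [Field K]

theorem laurent_zsmul {σ : Type*} [Fintype σ] (t : ℤ) (z : σ → ℤ) :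
    laurent K (t • z) = laurent K z ^ t := by
  rw [laurent, laurent, ← Finset.prod_zpow]
  refine Finset.prod_congr rfl fun i _ => ?_
  rw [← zpow_mul, Pi.smul_apply, smul_eq_mul, mul_comm]

theorem laurent_ne_zero {σ : Type*} [Fintype σ] (z : σ → ℤ) : laurent K z ≠ 0 :=
  Finset.prod_ne_zero_iff.mpr fun i _ => zpow_ne_zero _ (algebraMap_X_ne_zero i)

theorem monomial_mem_adjoin {σ R : Type*} [CommRing R] {s : Set σ} {α : σ →₀ ℕ}
    (h : ∀ j, j ∉ s → α j = 0) (c : R) :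
    (monomial α c : MvPowerSeries σ R) ∈ Algebra.adjoin R (X '' s) := by
  rw [← mul_one c, ← smul_eq_mul, map_smul, monomial_one_eq]
  refine Subalgebra.smul_mem _ (Subalgebra.prod_mem _ fun i _ => ?_) c
  change X i ^ α i ∈ _
  by_cases hi : i ∈ s
  · exact Subalgebra.pow_mem _ (Algebra.subset_adjoin (Set.mem_image_of_mem _ hi)) _
  · rw [h i hi, pow_zero]
    exact one_mem _

/-- Units `wⱼ` with exponents in `P`, where `wⱼ` is a polynomial in the variables before `xⱼ`. -/
structure IsTriangular (P : AddSubgroup (Fin n → ℤ)) (w : Fin n → MvPowerSeries (Fin n) K) :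
    Prop where
  mem_adjoin : ∀ j, w j ∈ Algebra.adjoin K (X '' Set.Iio j)
  constantCoeff_eq_one : ∀ j, constantCoeff (w j) = 1
  mem_supported : ∀ j, w j ∈ supported K (natPoints P)

theorem isTriangular_one (P : AddSubgroup (Fin n → ℤ)) :
    IsTriangular P fun _ => (1 : MvPowerSeries (Fin n) K) :=
  ⟨fun _ => one_mem _, fun _ => map_one _, fun _ => one_mem _⟩

variable {P : AddSubgroup (Fin n → ℤ)} {w : Fin n → MvPowerSeries (Fin n) K} {N m : ℕ}

theorem IsTriangular.update (hw : IsTriangular P w) {i : Fin n} {γ : Fin n →₀ ℕ}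
    (hγ : castHom (Fin n) γ ∈ initialPart P i) {c : K} (hc : γ = 0 → c = 0) :
    IsTriangular P (Function.update w i (1 + monomial γ c)) where
  mem_adjoin := (Function.forall_update_iff w fun j v => v ∈ Algebra.adjoin K (X '' Set.Iio j)).mpr
    ⟨add_mem (one_mem _) (monomial_mem_adjoin
      (fun j hj => Nat.cast_eq_zero.mp
        ((castHom_apply γ j).symm.trans (hγ.2 j (not_lt.mp hj)))) c), fun j _ => hw.mem_adjoin j⟩
  constantCoeff_eq_one := (Function.forall_update_iff w fun _ v => constantCoeff v = 1).mpr
    ⟨by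
      classical
      rw [map_add, map_one, ← coeff_zero_eq_constantCoeff_apply, MvPowerSeries.coeff_monomial,
        add_eq_left, ite_eq_right_iff]
      exact fun h => hc h.symm, fun j _ => hw.constantCoeff_eq_one j⟩
  mem_supported := (Function.forall_update_iff w fun _ v => v ∈ supported K (natPoints P)).mpr
    ⟨add_mem (one_mem _) (monomial_mem_supported (mem_natPoints.mpr hγ.1) c),
      fun j _ => hw.mem_supported j⟩

/-- The field generated over `K` by the `xⱼ ^ N * wⱼ ^ m` with `j < i`. -/
noncomputable def triangularField (N m : ℕ) (w : Fin n → MvPowerSeries (Fin n) K) (i : ℕ) :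
    IntermediateField K (FractionRing (MvPowerSeries (Fin n) K)) :=
  IntermediateField.adjoin K {x | ∃ j : Fin n, (j : ℕ) < i ∧ x = algebraMap _ _ (X j ^ N * w j ^ m)}

theorem mem_triangularField {i : ℕ} {j : Fin n} (hj : (j : ℕ) < i) :
    algebraMap _ _ (X j ^ N * w j ^ m) ∈ triangularField N m w i :=
  IntermediateField.subset_adjoin _ _ ⟨j, hj, rfl⟩

theorem triangularField_le {i : ℕ}
    {M : IntermediateField K (FractionRing (MvPowerSeries (Fin n) K))}
    (h : ∀ j : Fin n, (j : ℕ) < i → algebraMap _ _ (X j ^ N * w j ^ m) ∈ M) :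
    triangularField N m w i ≤ M := by
  rw [triangularField, IntermediateField.adjoin_le_iff]
  rintro _ ⟨j, hj, rfl⟩
  exact h j hj

theorem isAlgebraic_algebraMap_X (hN : N ≠ 0) (hw : IsTriangular P w) {i : ℕ} (j : Fin n)
    (hj : (j : ℕ) < i) : IsAlgebraic (triangularField N m w i)
      (algebraMap (MvPowerSeries (Fin n) K) (FractionRing (MvPowerSeries (Fin n) K)) (X j)) := by
  induction j using WellFoundedLT.induction with
  | ind j ih =>
    let F := triangularField N m w i
    let S := (algebraicClosure F (FractionRing (MvPowerSeries (Fin n) K))).restrictScalars K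
    have hS : ∀ x, x ∈ S ↔ IsAlgebraic F x := fun x => mem_algebraicClosure_iff
    have hadjoin : Algebra.adjoin K (X '' Set.Iio j) ≤ S.toSubalgebra.comap
        (IsScalarTower.toAlgHom K (MvPowerSeries (Fin n) K) (FractionRing _)) := by
      rw [Algebra.adjoin_le_iff]
      rintro _ ⟨l, hl, rfl⟩
      exact (hS _).mpr (ih l hl (lt_trans hl hj))
    have hwS : algebraMap (MvPowerSeries (Fin n) K) (FractionRing _) (w j) ∈ S :=
      hadjoin (hw.mem_adjoin j)
    have hgen : algebraMap (MvPowerSeries (Fin n) K) (FractionRing _) (X j ^ N * w j ^ m) ∈ S := by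
      rw [hS]
      exact isAlgebraic_algebraMap (⟨_, mem_triangularField hj⟩ : F)
    have hw0 : algebraMap _ (FractionRing (MvPowerSeries (Fin n) K)) (w j) ≠ 0 := by
      refine (map_ne_zero_iff _ (IsFractionRing.injective _ _)).mpr fun h => ?_
      exact zero_ne_one ((map_zero _).symm.trans (h ▸ hw.constantCoeff_eq_one j))
    have hpow : algebraMap (MvPowerSeries (Fin n) K) (FractionRing _) (X j) ^ N ∈ S := by
      have hdiv := div_mem hgen (pow_mem hwS m)
      rwa [map_mul, map_pow, map_pow, mul_div_cancel_right₀ _ (pow_ne_zero _ hw0)] at hdiv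
    exact IsAlgebraic.of_pow (Nat.pos_of_ne_zero hN) ((hS _).mp hpow)

theorem isAlgebraic_laurent (hN : N ≠ 0) (hw : IsTriangular P w) {i : ℕ} {z : Fin n → ℤ}
    (hz : z ∈ initialPart P i) : IsAlgebraic (triangularField N m w i) (laurent K z) := by
  rw [← mem_algebraicClosure_iff, laurent]
  refine prod_mem fun j _ => ?_
  by_cases hj : (j : ℕ) < i
  · exact zpow_mem (mem_algebraicClosure_iff.mpr (isAlgebraic_algebraMap_X hN hw j hj)) _
  · rw [hz.2 j (not_lt.mp hj), zpow_zero]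
    exact one_mem _

/-- The Laurent monomials with exponents in `initialPart P i` are generated over
`triangularField N m w i` by the single monomial `x ^ b`. -/
structure IsMonomialGenerator (P : AddSubgroup (Fin n → ℤ)) (N m : ℕ)
    (w : Fin n → MvPowerSeries (Fin n) K) (i : ℕ) (b : Fin n →₀ ℕ) : Prop where
  mem_initialPart : castHom (Fin n) b ∈ initialPart P i
  laurent_mem : ∀ z ∈ initialPart P i, laurent K z ∈
    IntermediateField.adjoin (triangularField N m w i) {laurent K (castHom (Fin n) b)}

theorem isMonomialGenerator_zero (P : AddSubgroup (Fin n → ℤ)) (N m : ℕ)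
    (w : Fin n → MvPowerSeries (Fin n) K) : IsMonomialGenerator P N m w 0 0 where
  mem_initialPart := by
    rw [map_zero]
    exact zero_mem _
  laurent_mem z hz := by
    rw [show z = 0 from funext fun j => hz.2 j (Nat.zero_le _)]
    simp [laurent]

theorem mem_adjoin_simple_iff_forall {k E : Type*} [Field k] [Field E] [Algebra k E]
    {F : IntermediateField k E} {x y : E} :
    y ∈ IntermediateField.adjoin F {x} ↔
      ∀ M : IntermediateField k E, F ≤ M → x ∈ M → y ∈ M where
  mp hy _ hFM hx :=
    (IntermediateField.adjoin_simple_le_iff (K := IntermediateField.extendScalars hFM)).mpr hx hy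
  mpr h := h ((IntermediateField.adjoin F {x}).restrictScalars k)
    (fun z hz => (IntermediateField.adjoin F {x}).algebraMap_mem ⟨z, hz⟩)
    (IntermediateField.mem_adjoin_simple_self F x)

theorem IsMonomialGenerator.exists_mem_adjoin [Infinite K] (hN : N ≠ 0) (hm : (m : K) ≠ 0)
    (hw : IsTriangular P w) {i : ℕ} {b : Fin n →₀ ℕ} (hb : IsMonomialGenerator P N m w i b)
    {z : Fin n → ℤ} (hz : z ∈ initialPart P i) :
    ∃ c : K, (b = 0 → c = 0) ∧ laurent K (castHom (Fin n) b) ∈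
      IntermediateField.adjoin (triangularField N m w i) {(laurent K z)⁻¹ *
        (1 + algebraMap K _ c * (laurent K z * laurent K (castHom (Fin n) b))) ^ m} := by
  rcases eq_or_ne b 0 with rfl | hb0
  · refine ⟨0, fun _ => rfl, ?_⟩
    simp [laurent]
  · obtain ⟨c, hc⟩ := exists_mem_adjoin_of_isAlgebraic hm
      (isAlgebraic_laurent hN hw hb.mem_initialPart) (laurent_ne_zero z) (hb.laurent_mem z hz)
    exact ⟨c, fun h => absurd h hb0, hc⟩

theorem laurent_inv_mul_one_add_pow {a b g : Fin n →₀ ℕ} {i : Fin n} {k : ℕ}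
    (h : k • a = g + Finsupp.single i N) (c : K) :
    (laurent K (castHom (Fin n) g))⁻¹ * (1 + algebraMap K _ c *
      (laurent K (castHom (Fin n) g) * laurent K (castHom (Fin n) b))) ^ m =
        algebraMap _ _ (X i ^ N * (1 + monomial (g + b) c) ^ m) /
          laurent K (castHom (Fin n) a) ^ k := by
  have hpow : laurent K (castHom (Fin n) a) ^ k = laurent K (castHom (Fin n) g) *
      algebraMap (MvPowerSeries (Fin n) K) _ (X i) ^ N := by
    rw [← map_pow, X_pow_eq, ← laurent_castHom, ← laurent_add, ← map_add, ← h, map_nsmul,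
      ← natCast_zsmul, laurent_zsmul, zpow_natCast]
  have hmon : algebraMap (MvPowerSeries (Fin n) K) (FractionRing _) (monomial (g + b) c) =
      algebraMap K _ c * (laurent K (castHom (Fin n) g) * laurent K (castHom (Fin n) b)) := by
    have hsmul : monomial (g + b) c = algebraMap K _ c * monomial (g + b) 1 := by
      rw [← Algebra.smul_def, ← map_smul, smul_eq_mul, mul_one]
    rw [hsmul, map_mul, ← IsScalarTower.algebraMap_apply, ← laurent_add, ← map_add, laurent_castHom]
  rw [hpow, map_mul, map_pow, map_pow, map_add, map_one, hmon,
    mul_comm (laurent K (castHom (Fin n) g)) (algebraMap _ _ (X i) ^ N),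
    mul_div_mul_left _ _ (pow_ne_zero _ (algebraMap_X_ne_zero i)), div_eq_inv_mul]

-- With `k a = g + N eᵢ`, the element `(xᵢ ^ N wᵢ ^ m) / (x ^ a) ^ k` of the new field is
-- `x ^ (-g) wᵢ ^ m`, and the choice of `c` makes it generate `x ^ b`.
theorem IsMonomialGenerator.laurent_mem_of_triangularField_le {i : Fin n} {a b g : Fin n →₀ ℕ}
    {k : ℕ} {c : K} (hb : IsMonomialGenerator P N m w i b)
    (hag : k • a = g + Finsupp.single i N)
    (hc : laurent K (castHom (Fin n) b) ∈
      IntermediateField.adjoin (triangularField N m w i) {(laurent K (castHom (Fin n) g))⁻¹ *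
        (1 + algebraMap K _ c *
          (laurent K (castHom (Fin n) g) * laurent K (castHom (Fin n) b))) ^ m})
    {M : IntermediateField K (FractionRing (MvPowerSeries (Fin n) K))}
    (hM : triangularField N m (Function.update w i (1 + monomial (g + b) c)) (i + 1) ≤ M)
    (haM : laurent K (castHom (Fin n) a) ∈ M) {z : Fin n → ℤ} (hz : z ∈ initialPart P i) :
    laurent K z ∈ M := by
  have hFM : triangularField N m w i ≤ M := triangularField_le fun j hj => by
    have hjM := hM (mem_triangularField (hj.trans (Nat.lt_succ_self _)))
    rwa [Function.update_of_ne (Fin.ne_of_lt hj)] at hjM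
  have hiM := hM (mem_triangularField (Nat.lt_succ_self i.val))
  rw [Function.update_self] at hiM
  refine mem_adjoin_simple_iff_forall.mp (hb.laurent_mem _ hz) M hFM
    (mem_adjoin_simple_iff_forall.mp hc M hFM ?_)
  rw [laurent_inv_mul_one_add_pow hag]
  exact div_mem hiM (pow_mem haM k)

theorem IsMonomialGenerator.update {i : Fin n} {a b g : Fin n →₀ ℕ} {k : ℕ} {c : K}
    (hb : IsMonomialGenerator P N m w i b) (ha : castHom (Fin n) a ∈ initialPart P (i + 1))
    (hag : k • a = g + Finsupp.single i N)
    (hdiv : ∀ z ∈ initialPart P (i + 1),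
      ∃ t : ℤ, z - t • castHom (Fin n) a ∈ initialPart P i)
    (hc : laurent K (castHom (Fin n) b) ∈
      IntermediateField.adjoin (triangularField N m w i) {(laurent K (castHom (Fin n) g))⁻¹ *
        (1 + algebraMap K _ c *
          (laurent K (castHom (Fin n) g) * laurent K (castHom (Fin n) b))) ^ m}) :
    IsMonomialGenerator P N m (Function.update w i (1 + monomial (g + b) c)) (i + 1) a := by
  refine ⟨ha, fun z hz => ?_⟩
  obtain ⟨t, ht⟩ := hdiv z hz
  refine mem_adjoin_simple_iff_forall.mpr fun M hM haM => ?_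
  have hsub := hb.laurent_mem_of_triangularField_le hag hc hM haM ht
  rw [← sub_add_cancel z (t • castHom (Fin n) a), laurent_add, laurent_zsmul]
  exact mul_mem hsub (zpow_mem haM t)

theorem exists_isTriangular_isMonomialGenerator [Infinite K] (hN : N ≠ 0) (hm : (m : K) ≠ 0)
    (hP : ∀ z, N • z ∈ P) (i : ℕ) (hi : i ≤ n) :
    ∃ (w : Fin n → MvPowerSeries (Fin n) K) (b : Fin n →₀ ℕ),
      IsTriangular P w ∧ IsMonomialGenerator P N m w i b := by
  induction i with
  | zero => exact ⟨_, 0, isTriangular_one P, isMonomialGenerator_zero P N m _⟩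
  | succ i ih =>
    obtain ⟨w, b, hw, hb⟩ := ih (Nat.le_of_succ_le hi)
    obtain ⟨a, g, k, ha, hg, hag, hdiv⟩ := exists_minimal_vector hN hP ⟨i, hi⟩
    obtain ⟨c, hc0, hc⟩ := hb.exists_mem_adjoin hN hm hw hg
    refine ⟨_, a, hw.update (i := ⟨i, hi⟩) ?_ fun h => hc0 (add_eq_zero.mp h).2,
      hb.update (i := ⟨i, hi⟩) ha hag hdiv hc⟩
    rw [map_add]
    exact add_mem hg hb.mem_initialPart

theorem IsTriangular.isPuiseux [IsAlgClosed K] (hw : IsTriangular P w) {p k : ℕ} [ExpChar K p]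
    (hq : p ^ k ≠ 0) (hm : (m : K) ≠ 0) (hm0 : m ≠ 0) {b : Fin n →₀ ℕ}
    {f : (MvPowerSeries (Fin n) K)[X]} (hf : f.Monic) (hirr : Irreducible f)
    (hfb : f.eval₂ (twist (mul_ne_zero hq hm0) fun i => w i ^ m).toRingHom (monomial b 1) = 0) :
    IsPuiseux f := by
  have : ExpChar (MvPowerSeries (Fin n) K) p :=
    expChar_of_injective_algebraMap (algebraMap K _).injective p
  obtain ⟨e, he⟩ := exists_X_mem_powPreimage hq hw.mem_adjoin hw.constantCoeff_eq_one
  have hmem : monomial b 1 ∈ powPreimage p e (twist hq w).range := by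
    rw [monomial_one_eq]
    exact prod_mem fun i _ => pow_mem (he i) _
  rw [twist_comp_expand hq hm0] at hfb
  exact isPuiseux_of_pow_mem_range (pow_ne_zero e (expChar_pos K p).ne') hm hm0
    (ψ := (twist hq w).toRingHom) (twist_injective hq hw.constantCoeff_eq_one) hf hirr hfb hmem

theorem IsMonomialGenerator.monomial_mem_genField (hN : N ≠ 0) {b : Fin n →₀ ℕ}
    (hb : IsMonomialGenerator P N m w n b) {α : Fin n →₀ ℕ} (hα : α ∈ natPoints P) :
    algebraMap (MvPowerSeries (Fin n) K) _ (monomial α 1) ∈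
      genField (twist hN fun i => w i ^ m).toRingHom {monomial b 1} := by
  set L := genField (twist hN fun i => w i ^ m).toRingHom {(monomial b 1 :
    MvPowerSeries (Fin n) K)}
  have htwist (x) : algebraMap _ _ (twist hN (fun i => w i ^ m) x) ∈ L :=
    algebraMap_mem_genField _ _ x
  have hK (x : K) : algebraMap K _ x ∈ L := by
    rw [IsScalarTower.algebraMap_apply K (MvPowerSeries (Fin n) K), ← (twist hN _).commutes]
    exact htwist _
  rw [← laurent_castHom]
  refine mem_adjoin_simple_iff_forall.mp (hb.laurent_mem _ ⟨hα, fun j hj => ?_⟩)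
    (L.toIntermediateField hK) (triangularField_le fun j _ => ?_) ?_
  · exact absurd j.2 (not_lt.mpr hj)
  · have hX := htwist (X j)
    rwa [twist_X] at hX
  · rw [laurent_castHom]
    exact mem_genField_of_mem _ (Set.mem_singleton _)

theorem exists_isPuiseux_of_lattice [IsAlgClosed K] (hN : N ≠ 0) (hP : ∀ z, N • z ∈ P) :
    ∃ f : (MvPowerSeries (Fin n) K)[X], IsPuiseux f ∧ Irreducible f ∧
      Nonempty (Normalization (AdjoinRoot f) ≃ₐ[K] supported K (natPoints P)) := by
  obtain ⟨p, hp⟩ := ExpChar.exists K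
  obtain ⟨k, m, hm, rfl⟩ := exists_eq_pow_mul_and_natCast_ne_zero K p hN
  have hq : p ^ k ≠ 0 := left_ne_zero_of_mul hN
  have : Infinite K := IsAlgClosed.instInfinite
  obtain ⟨w, b, hw, hb⟩ := exists_isTriangular_isMonomialGenerator hN hm hP n le_rfl
  have hu1 (i) : constantCoeff (w i ^ m) = 1 := by
    rw [map_pow, hw.constantCoeff_eq_one, one_pow]
  obtain ⟨f, hf, hirr, hfb⟩ := exists_irreducible_of_isIntegral
    (isIntegral_twist hN (u := fun i => w i ^ m) hu1) (monomial b 1)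
  exact ⟨f, hw.isPuiseux hq hm (right_ne_zero_of_mul hN) hf hirr hfb, hirr,
    (nonempty_normalization_equiv_supported hN (isFull_natPoints P) (nsmul_mem_natPoints hP)
      (fun i => pow_mem (hw.mem_supported i) m) hu1 hf hirr
      (monomial_mem_supported (mem_natPoints.mpr hb.mem_initialPart.1) 1) hfb
      fun α hα => hb.monomial_mem_genField hN hα).2⟩

end Wild

section Converse

variable {n : ℕ} {M : AddSubgroup (Fin n → ℚ)} {v : Fin n → Fin n → ℤ}

theorem IsSimplicialPair.exists_equiv (h : IsSimplicialPair M v) :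
    ∃ (N : ℕ) (P : AddSubgroup (Fin n → ℤ)), N ≠ 0 ∧ (∀ z, N • z ∈ P) ∧
      Nonempty (semigroup M (cone v) ≃+ natPoints P) := by
  obtain ⟨N, hN, hM⟩ := exists_common_denominator h
  refine ⟨N, _, hN, nsmul_mem_comap_latMap (fun i => ?_) hN,
    nonempty_semigroup_equiv h.linearIndependent hN (r := fun _ => 1) (fun _ => one_pos) ?_⟩
  · simpa only [one_mul] using h.int_mem (v i)
  · simpa only [one_mul] using hM

theorem IsSimplicialPair.exists_equiv_relIndex (h : IsSimplicialPair M v)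
    (hk : (rayLattice M v).relIndex M ≠ 0) :
    ∃ P : AddSubgroup (Fin n → ℤ), (∀ z, (rayLattice M v).relIndex M • z ∈ P) ∧
      Nonempty (semigroup M (cone v) ≃+ natPoints P) := by
  obtain ⟨r, hr, hgen⟩ := exists_ray_generators h
  exact ⟨_, nsmul_mem_comap_latMap (fun i => (hgen i _).mpr ⟨1, by rw [Int.cast_one, one_mul]⟩) hk,
    nonempty_semigroup_equiv h.linearIndependent hk hr
      (le_range_latMap_relIndex hk fun i t => (hgen i t).mp)⟩

variable {K : Type*} [Field K] [IsAlgClosed K]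

theorem exists_isPuiseux_of_not_dvd_relIndex (h : IsSimplicialPair M v)
    (hk : ¬ ringChar K ∣ (rayLattice M v).relIndex M) :
    ∃ (f : (MvPowerSeries (Fin n) K)[X]) (_ : IsLocalRing (Normalization (AdjoinRoot f))),
      IsPuiseux f ∧ Irreducible f ∧ ¬ ringChar K ∣ f.natDegree ∧
        AnalyticallyIsomorphic K (IsLocalRing.maximalIdeal (Normalization (AdjoinRoot f)))
          (specialIdeal K (semigroup M (cone v))) := by
  have hk0 : (rayLattice M v).relIndex M ≠ 0 := fun h => hk (h ▸ dvd_zero _)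
  rw [← ringChar.spec] at hk
  obtain ⟨P, hP, ⟨ε⟩⟩ := h.exists_equiv_relIndex hk0
  have hT := isFull_natPoints P
  have hNT := nsmul_mem_natPoints hP
  obtain ⟨f, hf, hirr, hdeg, ⟨e⟩⟩ := exists_isPuiseux_of_natCast_ne_zero hk hT hNT
  obtain ⟨hloc, hiso⟩ := exists_isLocalRing_of_algEquiv hT (fg_of_isFull hk0 hT hNT) e ε
  refine ⟨f, hloc, hf, hirr, fun hd => ?_, hiso⟩
  have hpow := (ringChar.spec K _).mpr (hd.trans hdeg)
  rw [Nat.cast_pow] at hpow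
  exact pow_ne_zero n hk hpow

theorem exists_isPuiseux_analyticallyIsomorphic (h : IsSimplicialPair M v) :
    ∃ (f : (MvPowerSeries (Fin n) K)[X]) (_ : IsLocalRing (Normalization (AdjoinRoot f))),
      IsPuiseux f ∧ Irreducible f ∧
        AnalyticallyIsomorphic K (IsLocalRing.maximalIdeal (Normalization (AdjoinRoot f)))
          (specialIdeal K (semigroup M (cone v))) := by
  obtain ⟨N, P, hN, hP, ⟨ε⟩⟩ := h.exists_equiv
  have hT := isFull_natPoints P
  obtain ⟨f, hf, hirr, ⟨e⟩⟩ := exists_isPuiseux_of_lattice (K := K) hN hP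
  obtain ⟨hloc, hiso⟩ := exists_isLocalRing_of_algEquiv hT
    (fg_of_isFull hN hT (nsmul_mem_natPoints hP)) e ε
  exact ⟨f, hloc, hf, hirr, hiso⟩

end Converse

end PuiseuxHypersurface

open PuiseuxHypersurface in
theorem theorem5p2 {K : Type*} [Field K] [IsAlgClosed K] (n : ℕ) :
    (∀ f : Polynomial (MvPowerSeries (Fin n) K),
      IsPuiseux f → Irreducible f → ¬ ringChar K ∣ f.natDegree →
        ∃ _ : IsLocalRing (Normalization (AdjoinRoot f)),
          IsRegularLocalRing (Normalization (AdjoinRoot f)) ∨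
            IsHirzebruchJung K n (Normalization (AdjoinRoot f))) ∧
    (∀ (R : Type*) [CommRing R] [Algebra K R] [IsLocalRing R]
      (M : AddSubgroup (Fin n → ℚ)) (v : Fin n → Fin n → ℤ), IsHirzebruchJungOf K M v R →
        ∃ f : Polynomial (MvPowerSeries (Fin n) K),
          IsPuiseux f ∧ Irreducible f ∧
          (¬ ringChar K ∣ (rayLattice M v).relIndex M → ¬ ringChar K ∣ f.natDegree) ∧
          ∃ _ : IsLocalRing (Normalization (AdjoinRoot f)),
            AnalyticallyIsomorphic K (IsLocalRing.maximalIdeal R)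
              (IsLocalRing.maximalIdeal (Normalization (AdjoinRoot f)))) := by
  refine ⟨fun f hf hirr hd => isRegularLocalRing_or_isHirzebruchJung hf hirr hd,
    fun R _ _ _ M v hR => ?_⟩
  by_cases hk : ringChar K ∣ (rayLattice M v).relIndex M
  · obtain ⟨f, hloc, hf, hirr, hiso⟩ :=
      exists_isPuiseux_analyticallyIsomorphic (K := K) hR.pair
    exact ⟨f, hf, hirr, fun h => absurd hk h, hloc, hR.analyticallyIsomorphic.trans hiso.symm⟩
  · obtain ⟨f, hloc, hf, hirr, hd, hiso⟩ :=
      exists_isPuiseux_of_not_dvd_relIndex (K := K) hR.pair hk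
    exact ⟨f, hf, hirr, fun _ => hd, hloc, hR.analyticallyIsomorphic.trans hiso.symm⟩
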